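/- Let $n\ge 2$ and $r\ge 1$ be integers, and let $S^n=\{y\in\mathbb R^{n+1}: y_1^2+\dots+y_{n+1}^2=1\}$ be the round unit sphere with its Laplace--Beltrami operator $\tau$ (acting on complex-valued functions). A smooth function $f:W\to\mathbb C$ on an open set $W\subseteq S^n$ is called *proper $r$-harmonic* if $\tau^r(f)=0$ on $W$ and $\tau^{r-1}(f)$ does not vanish identically on $W$. Let $h:\mathbb R^{n-1}\to\mathbb C$ be a non-constant harmonic function (for the Euclidean metric) and let $p_r:(0,\infty)\to\mathbb C$ be $$p_r(t)=(a+b\,t^{n-1})\,(\log t)^{r-1},\qquad (a,b)\in\mathbb C^2\setminus\{(0,0)\}.$$ A *local complex analytic extension* $p_r^*$ of $p_r$ is a complex analytic function on a connected open set $V\subseteq\mathbb C$ that agrees with $p_r$ on the positive reals near some point of $V\cap(0,\infty)$; a local complex analytic extension $h^*$ of $h$ is a complex analytic function on a connected open set $U\subseteq\mathbb C^{n-1}$ that agrees with $h$ on the real points near some point of $U\cap\mathbb R^{n-1}$. (i) For every $q\in S^n$ with $q_1=0$ and $q_2>0$ there are local complex analytic extensions $p_r^*$ on $V$ and $h^*$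 on $U$, agreeing with $p_r$ on all of $V\cap(0,\infty)$ and with $h$ on all of $U\cap\mathbb R^{n-1}$, and an open set $W\subseteq S^n$ containing $q$, such that for all $y\in W$ $$y_2+iy_1\neq 0,\qquad \frac{2|y|}{y_2+iy_1}\in V,\qquad \Bigl(\frac{2y_3}{y_2+iy_1},\dots,\frac{2y_{n+1}}{y_2+iy_1}\Bigr)\in U .\tag{$*$}$$ (ii) For all local complex analytic extensions $p_r^*$ of $p_r$ on $V$ and $h^*$ of $h$ on $U$, and every non-empty open set $W\subseteq S^n$ on which $(*)$ holds, the function $f_r:W\to\mathbb C$, $$f_r(y)=p_r^*\Bigl(\frac{2|y|}{y_2+iy_1}\Bigr)\cdot h^*\Bigl(\frac{2y_3}{y_2+iy_1},\dots,\frac{2y_{n+1}}{y_2+iy_1}\Bigr),$$ is smooth and proper $r$-harmonic. -/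

import Mathlib

open scoped Manifold ContDiff Topology

noncomputable section

namespace PolyharmonicSphere

/-- The round unit sphere `S^n` in `ℝ^{n+1}`, with Mathlib's smooth structure. -/
abbrev Sphere (n : ℕ) : Type := Metric.sphere (0 : EuclideanSpace ℝ (Fin (n + 1))) 1

/-- The partial derivative `∂u/∂x_i`. -/
def partialDeriv {n : ℕ} {F : Type*} [NormedAddCommGroup F] [NormedSpace ℝ F] (i : Fin n)
    (u : EuclideanSpace ℝ (Fin n) → F) (x : EuclideanSpace ℝ (Fin n)) : F :=
  fderiv ℝ u x (EuclideanSpace.single i 1)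

/-- The Laplace-Beltrami operator in coordinates: for a metric with coefficient matrix
`g = (g_{ij})` and a complex-valued function `u` of the coordinates,
`∑_{i,j} |g|^{-1/2} ∂_j (g^{ij} |g|^{1/2} ∂_i u)`. -/
def coordLaplaceBeltrami {n : ℕ} (g : EuclideanSpace ℝ (Fin n) → Matrix (Fin n) (Fin n) ℝ)
    (u : EuclideanSpace ℝ (Fin n) → ℂ) (x : EuclideanSpace ℝ (Fin n)) : ℂ :=
  ∑ i : Fin n, ∑ j : Fin n, (1 / √|(g x).det|) •
    partialDeriv j (fun z => ((g z)⁻¹ i j * √|(g z).det|) • partialDeriv i u z) x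

/-- The coefficients `g_{ij} = ⟨∂_i, ∂_j⟩` of the round metric (the one induced from `ℝ^{n+1}`)
in a chart `e` of the sphere. -/
def roundMetric {n : ℕ} (e : OpenPartialHomeomorph (Sphere n) (EuclideanSpace ℝ (Fin n)))
    (x : EuclideanSpace ℝ (Fin n)) : Matrix (Fin n) (Fin n) ℝ :=
  Matrix.of fun i j =>
    inner ℝ (partialDeriv i (fun z => (e.symm z : EuclideanSpace ℝ (Fin (n + 1)))) x)
      (partialDeriv j (fun z => (e.symm z : EuclideanSpace ℝ (Fin (n + 1)))) x)

/-- The Laplace-Beltrami operator (tension field) `τ` of the round sphere, computed at `y` by the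
coordinate formula in the chart `chartAt _ y` around `y`. It is a local operator: on an open set
where `f` is smooth, `τ f` depends only on the values of `f` there. -/
def tension {n : ℕ} (f : Sphere n → ℂ) (y : Sphere n) : ℂ :=
  coordLaplaceBeltrami (roundMetric (chartAt (EuclideanSpace ℝ (Fin n)) y))
    (fun x => f ((chartAt (EuclideanSpace ℝ (Fin n)) y).symm x))
    (chartAt (EuclideanSpace ℝ (Fin n)) y y)

/-- `f` is smooth on `W` and proper `r`-harmonic there: `τ^r f = 0` on `W`, and `τ^{r-1} f` does not
vanish identically on `W`. To be used with `W` open and `1 ≤ r`. -/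
structure IsProperHarmonicOn {n : ℕ} (r : ℕ) (f : Sphere n → ℂ) (W : Set (Sphere n)) : Prop where
  smooth : ContMDiffOn (𝓡 n) 𝓘(ℝ, ℂ) ∞ f W
  tension_eq_zero : ∀ y ∈ W, (tension^[r] f) y = 0
  proper : ∃ y ∈ W, (tension^[r - 1] f) y ≠ 0

/-- The function `p_r(t) = (a + b t^{n-1}) (log t)^{r-1}`, used for `t > 0`. -/
def radial (n r : ℕ) (a b : ℂ) (t : ℝ) : ℂ :=
  (a + b * (t : ℂ) ^ (n - 1)) * (Real.log t : ℂ) ^ (r - 1)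

/-- `P`, complex analytic on the connected open set `V ⊆ ℂ`, is a local complex analytic extension
of `p : (0, ∞) → ℂ`: it agrees with `p` on the positive reals near some `t₀ > 0` in `V`. -/
structure IsExtensionPos (p : ℝ → ℂ) (V : Set ℂ) (P : ℂ → ℂ) : Prop where
  isOpen : IsOpen V
  isPreconnected : IsPreconnected V
  analytic : AnalyticOnNhd ℂ P V
  agree : ∃ t₀ : ℝ, 0 < t₀ ∧ (t₀ : ℂ) ∈ V ∧ ∀ᶠ t : ℝ in 𝓝 t₀, P (t : ℂ) = p t

/-- `H`, complex analytic on the connected open set `U ⊆ ℂ^m`, is a local complex analytic extension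
of `h : ℝ^m → ℂ`: it agrees with `h` on the real points near some `x₀ ∈ ℝ^m` in `U`. -/
structure IsExtensionReal {m : ℕ} (h : EuclideanSpace ℝ (Fin m) → ℂ) (U : Set (Fin m → ℂ))
    (H : (Fin m → ℂ) → ℂ) : Prop where
  isOpen : IsOpen U
  isPreconnected : IsPreconnected U
  analytic : AnalyticOnNhd ℂ H U
  agree : ∃ x₀ : EuclideanSpace ℝ (Fin m), (fun k => (x₀ k : ℂ)) ∈ U ∧
    ∀ᶠ x in 𝓝 x₀, H (fun k => (x k : ℂ)) = h x

/-- The complex number `y_2 + i y_1`. (Coordinates are numbered from `0` in the code, so that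
`y_1, y_2` are `y 0, y 1`.) -/
def denom {n : ℕ} (y : EuclideanSpace ℝ (Fin (n + 1))) : ℂ :=
  (y 1 : ℂ) + Complex.I * (y 0 : ℂ)

/-- `2|y| / (y_2 + i y_1)`. -/
def argT {n : ℕ} (y : EuclideanSpace ℝ (Fin (n + 1))) : ℂ :=
  2 * (‖y‖ : ℂ) / denom y

/-- `(2 y_3 / (y_2 + i y_1), …, 2 y_{n+1} / (y_2 + i y_1))`. -/
def argX {n : ℕ} (y : EuclideanSpace ℝ (Fin (n + 1))) : Fin (n - 1) → ℂ :=
  fun k => 2 * (y ⟨k.1 + 2, by have := k.2; omega⟩ : ℂ) / denom y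

/-- The function `f_r(y) = P (2|y| / (y_2 + i y_1)) H (2y_3 / (y_2 + i y_1), …)`. -/
def sphereFun {n : ℕ} (P : ℂ → ℂ) (H : (Fin (n - 1) → ℂ) → ℂ) (y : Sphere n) : ℂ :=
  P (argT (y : EuclideanSpace ℝ (Fin (n + 1)))) * H (argX (y : EuclideanSpace ℝ (Fin (n + 1))))

/-- `y_2 + i y_1 ≠ 0` on `W`, and the arguments of `P` and `H` in `sphereFun` stay in the domains
`V` and `U`. -/
def MapsInto {n : ℕ} (W : Set (Sphere n)) (V : Set ℂ) (U : Set (Fin (n - 1) → ℂ)) : Prop :=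
  ∀ y ∈ W, denom (y : EuclideanSpace ℝ (Fin (n + 1))) ≠ 0 ∧
    argT (y : EuclideanSpace ℝ (Fin (n + 1))) ∈ V ∧ argX (y : EuclideanSpace ℝ (Fin (n + 1))) ∈ U

end PolyharmonicSphere

end

/-! On the unit sphere put d = y_2 + iy_1, T = 2/d and X_k = 2y_{k+2}/d. The linear form d has an
isotropic coefficient vector (1 + i² = 0). With the complex bilinear extension of the round metric
this gives (∇T,∇T) = -T², (∇T,∇X_k) = 0, (∇X_k,∇X_l) = δ_kl T², τT = (n-2)T and τX_k = 0. Hence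
τ(P(T)H(X)) = (LP)(T)H(X) + T²P(T)(ΔH)(X) with LP = -s²P'' + (n-2)sP'. If ΔH = 0, the tension field
acts on the radial factor only (`tension_eq_of_eventuallyEq`, `iterate_tension_eq`).

In the variable u = log s, L is -∂² + (n-1)∂ = (n-1-∂)∂. On s^{n-1}q(u) it acts on q as (-(n-1)-∂)∂.
Each application lowers the degree in u by one, so L^r kills p_r, while L^{r-1}p_r is a combination
of 1 and s^{n-1} with coefficients nonzero multiples of a and b (`IsExtensionPos.iterate_radialOp`,
`IsExtensionPos.iterate_radialOp_pred`).

The image of the sphere under T or X need not be open. What replaces openness is an identity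
theorem: a holomorphic function vanishing on a set whose real velocities span the complex space at
each point vanishes nearby (`eventuallyEq_zero_of_span_velocities`). It carries ΔH = 0 from the real
points to U, and it shows that f_r cannot be killed by τ^{r-1} unless h = 0 or a = b = 0.

Existence of H requires h, a priori only C², to be analytic. A mean value property against a radial
density gives factorial bounds on the derivatives, so the Taylor series of h converges after
complexification (`exists_holomorphic_extension_of_harmonic`). -/

noncomputable section

namespace PolyharmonicSphere

/-! ### Mean value property of harmonic functions against a smooth radial density. -/

section

open MeasureTheory Filter Topology Set InnerProductSpace
open scoped ContDiff Convolution Laplacian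

section Kernel

variable {E : Type*} [NormedAddCommGroup E] [InnerProductSpace ℝ E] [FiniteDimensional ℝ E]
  [MeasurableSpace E] [BorelSpace E]

/-- A smooth radial probability density `ρ` on the unit ball, together with a potential `σ` of
the field `-ρ(y) y`. -/
theorem exists_radial_kernel : ∃ ρ σ : E → ℝ, ContDiff ℝ ∞ ρ ∧ ContDiff ℝ 1 σ ∧
    (∀ y, 1 ≤ ‖y‖ → ρ y = 0) ∧ (∀ y, 1 ≤ ‖y‖ → σ y = 0) ∧ ∫ y, ρ y = 1 ∧
    ∀ y v, fderiv ℝ σ y v = -(ρ y * inner ℝ y v) := by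
  set φ : ℝ → ℝ := fun s => expNegInvGlue (1 - s) with hφ
  have hφs : ContDiff ℝ ∞ φ := expNegInvGlue.contDiff.comp (contDiff_const.sub contDiff_id)
  have hφ1 : ∀ s, 1 ≤ s → φ s = 0 := fun s hs => expNegInvGlue.zero_of_nonpos (by linarith)
  -- The primitive is based at 1, so that it vanishes for s ≥ 1 and the potential σ has compact
  -- support.
  set A : ℝ → ℝ := fun s => ∫ u in (1 : ℝ)..s, φ u with hA
  have hA' : ∀ s, HasDerivAt A (φ s) s := fun s =>
    intervalIntegral.integral_hasDerivAt_right (hφs.continuous.intervalIntegrable _ _)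
      hφs.continuous.stronglyMeasurable.stronglyMeasurableAtFilter hφs.continuous.continuousAt
  have hAs : ContDiff ℝ 1 A := by
    rw [contDiff_one_iff_deriv]
    refine ⟨fun s => (hA' s).differentiableAt, ?_⟩
    have : deriv A = φ := funext fun s => (hA' s).deriv
    rw [this]; exact hφs.continuous
  have hA1 : ∀ s, 1 ≤ s → A s = 0 := by
    intro s hs
    simp only [hA]
    rw [intervalIntegral.integral_congr (g := fun _ => 0)]
    · simp
    · intro u hu
      rw [uIcc_of_le hs] at hu
      exact hφ1 u hu.1
  set g : E → ℝ := fun y => φ (‖y‖ ^ 2) with hg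
  have hgs : ContDiff ℝ ∞ g := hφs.comp (contDiff_norm_sq ℝ)
  have hg1 : ∀ y : E, 1 ≤ ‖y‖ → g y = 0 := fun y hy => hφ1 _ (one_le_pow₀ hy)
  have hgc : HasCompactSupport g := by
    refine HasCompactSupport.intro (isCompact_closedBall (0 : E) 1) fun y hy => hg1 y ?_
    simp at hy; exact hy.le
  have hI : 0 < ∫ y, g y := by
    refine hgs.continuous.integral_pos_of_hasCompactSupport_nonneg_nonzero hgc
      (fun y => expNegInvGlue.nonneg _) (x := 0) ?_
    simp [hg, hφ]
  set c : ℝ := (∫ y, g y)⁻¹ with hc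
  refine ⟨fun y => c * g y, fun y => -(c / 2) * A (‖y‖ ^ 2), contDiff_const.mul hgs,
    contDiff_const.mul (hAs.comp (contDiff_norm_sq ℝ)), fun y hy => by simp [hg1 y hy],
    fun y hy => by simp [hA1 _ (one_le_pow₀ hy)], ?_, ?_⟩
  · rw [integral_const_mul]; exact inv_mul_cancel₀ hI.ne'
  · intro y v
    have h1 : HasFDerivAt (fun y : E => ‖y‖ ^ 2) (2 • innerSL ℝ y) y :=
      (hasStrictFDerivAt_norm_sq y).hasFDerivAt
    have h2 := ((hA' (‖y‖ ^ 2)).comp_hasFDerivAt y h1).const_mul (-(c / 2))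
    have h3 : fderiv ℝ (fun y : E => -(c / 2) * A (‖y‖ ^ 2)) y = _ := h2.fderiv
    rw [h3]
    simp [hg]
    ring

end Kernel

section ParametricIntegral

variable {E : Type*} [NormedAddCommGroup E] [MeasurableSpace E] [BorelSpace E]
  [SecondCountableTopology E] {μ : Measure E} [IsFiniteMeasureOnCompacts μ]
  {P F : Type*} [NormedAddCommGroup P] [NormedSpace ℝ P] [ProperSpace P]
  [NormedAddCommGroup F] [NormedSpace ℝ F]

theorem hasFDerivAt_integral_smul_of_hasCompactSupport {ρ : E → ℝ} (hρ : Continuous ρ)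
    (hc : HasCompactSupport ρ) {k : P → E → F} {k' : P → E → P →L[ℝ] F}
    (hk : ∀ p y, HasFDerivAt (fun p => k p y) (k' p y) p) (hkc : Continuous (Function.uncurry k))
    (hkc' : Continuous (Function.uncurry k')) (p : P) :
    HasFDerivAt (fun p => ∫ y, ρ y • k p y ∂μ) (∫ y, ρ y • k' p y ∂μ) p := by
  obtain ⟨K, hK⟩ := ((isCompact_closedBall p 1).prod hc).exists_bound_of_continuousOn
    hkc'.continuousOn
  have hk1 : ∀ p, Continuous (k p) := fun p => hkc.comp (Continuous.prodMk_right p)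
  have hk2 : ∀ p, Continuous (k' p) := fun p => hkc'.comp (Continuous.prodMk_right p)
  have hint : Integrable ρ μ := hρ.integrable_of_hasCompactSupport hc
  refine hasFDerivAt_integral_of_dominated_of_fderiv_le (bound := fun y => |ρ y| * K)
    (F' := fun q y => ρ y • k' q y)
    (Metric.closedBall_mem_nhds p one_pos)
    (Eventually.of_forall fun q => (hρ.smul (hk1 q)).aestronglyMeasurable)
    ((hρ.smul (hk1 p)).integrable_of_hasCompactSupport hc.smul_right)
    (hρ.smul (hk2 p)).aestronglyMeasurable ?_ (hint.abs.mul_const K) ?_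
  · refine Eventually.of_forall fun y q hq => ?_
    rw [norm_smul, Real.norm_eq_abs]
    by_cases hy : y ∈ tsupport ρ
    · exact mul_le_mul_of_nonneg_left (hK (q, y) ⟨hq, hy⟩) (abs_nonneg _)
    · simp [image_eq_zero_of_notMem_tsupport hy]
  · exact Eventually.of_forall fun y q _ => (hk q y).const_smul (ρ y)

end ParametricIntegral

section MeanValue

variable {E : Type*} [NormedAddCommGroup E] [InnerProductSpace ℝ E] [FiniteDimensional ℝ E]
  [MeasurableSpace E] [BorelSpace E] {F : Type*} [NormedAddCommGroup F] [NormedSpace ℝ F]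

/-- The mean value property with respect to all dilations of the density `ρ`. -/
def HasMeanValue (ρ : E → ℝ) (h : E → F) : Prop :=
  ∀ (x : E) (ε : ℝ), ∫ y, ρ y • h (x + ε • y) = h x

/-- The derivative in ε of the average is ∫ρ ∇h(x+εy)·y. Since ρ(y)y = -∇σ, integration by parts
turns it into ε∫σ Δh(x+εy) = 0, so the average equals its value h(x) at ε = 0. Using a density
avoids integration over spheres. -/
theorem hasMeanValue_of_harmonic [CompleteSpace F] {ρ σ : E → ℝ} (hρ : ContDiff ℝ ∞ ρ)
    (hσ : ContDiff ℝ 1 σ) (hρ1 : ∀ y, 1 ≤ ‖y‖ → ρ y = 0) (hσ1 : ∀ y, 1 ≤ ‖y‖ → σ y = 0)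
    (hI : ∫ y, ρ y = 1) (hσρ : ∀ y v, fderiv ℝ σ y v = -(ρ y * inner ℝ y v))
    {h : E → F} (hh : HarmonicOnNhd h univ) : HasMeanValue ρ h := by
  intro x
  have hC2 : ContDiff ℝ 2 h := contDiffOn_univ.1 hh.contDiffOn
  have hC1 : ContDiff ℝ 1 (fderiv ℝ h) := hC2.fderiv_right (by norm_num)
  have hρc : HasCompactSupport ρ := 
    HasCompactSupport.intro (isCompact_closedBall (0 : E) 1) fun y hy => hρ1 y (by
      simp at hy; exact hy.le)
  have hσc : HasCompactSupport σ := 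
    HasCompactSupport.intro (isCompact_closedBall (0 : E) 1) fun y hy => hσ1 y (by
      simp at hy; exact hy.le)
  have hd : ∀ ε y, HasFDerivAt (fun ε : ℝ => h (x + ε • y))
      (fderiv ℝ h (x + ε • y) ∘L ContinuousLinearMap.toSpanSingleton ℝ y) ε := by
    intro ε y
    have h1 : HasFDerivAt (fun ε : ℝ => x + ε • y) (ContinuousLinearMap.toSpanSingleton ℝ y) ε :=
      (ContinuousLinearMap.toSpanSingleton ℝ y).hasFDerivAt.const_add x
    exact ((hC2.differentiable (by norm_num)) _).hasFDerivAt.comp ε h1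
  have hΦ : ∀ ε : ℝ, HasFDerivAt (fun ε : ℝ => ∫ y, ρ y • h (x + ε • y))
      (∫ y, ρ y • (fderiv ℝ h (x + ε • y) ∘L ContinuousLinearMap.toSpanSingleton ℝ y)) ε := by
    intro ε
    refine hasFDerivAt_integral_smul_of_hasCompactSupport hρ.continuous hρc
      (k := fun ε y => h (x + ε • y)) hd ?_ ?_ ε
    · exact hC2.continuous.comp (by fun_prop)
    · refine Continuous.clm_comp (hC1.continuous.comp (by fun_prop)) ?_
      exact (ContinuousLinearMap.toSpanSingletonCLE (𝕜 := ℝ) (E := E)).continuous.comp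
        continuous_snd
  set b := stdOrthonormalBasis ℝ E
  have hzero : ∀ ε : ℝ, HasDerivAt (fun ε : ℝ => ∫ y, ρ y • h (x + ε • y)) 0 ε := by
    intro ε
    have h0 := (hΦ ε).hasDerivAt
    convert h0 using 1
    have hρσ : ∀ y, ρ y • fderiv ℝ h (x + ε • y) y =
        ∑ i, -(fderiv ℝ σ y (b i) • fderiv ℝ h (x + ε • y) (b i)) := by
      intro y
      have key : ∀ L : E →L[ℝ] F, L y = ∑ i, inner ℝ y (b i) • L (b i) := by
        intro L
        conv_lhs => rw [← b.sum_repr y]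
        simp only [map_sum, map_smul, b.repr_apply_apply, real_inner_comm]
      rw [key]
      simp only [Finset.smul_sum, smul_smul, hσρ, neg_smul, neg_neg]
    have hGd : ∀ i y, HasFDerivAt (fun y => fderiv ℝ h (x + ε • y) (b i))
        (ε • (fderiv ℝ (fderiv ℝ h) (x + ε • y)).flip (b i)) y := by
      intro i y
      have h1 : HasFDerivAt (fun y : E => x + ε • y) (ε • ContinuousLinearMap.id ℝ E) y :=
        ((hasFDerivAt_id y).const_smul ε).const_add x
      have h2 := ((hC1.differentiable (by norm_num)) (x + ε • y)).hasFDerivAt.comp y h1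
      exact (h2.clm_apply (hasFDerivAt_const (b i) y)).congr_fderiv (by ext v; simp)
    have hGc : ∀ i, Continuous fun y => fderiv ℝ h (x + ε • y) (b i) := fun i =>
      (hC1.continuous.comp (by fun_prop)).clm_apply continuous_const
    have hGc' : ∀ i, Continuous fun y => ε • fderiv ℝ (fderiv ℝ h) (x + ε • y) (b i) (b i) :=
      fun i => ((((hC1.continuous_fderiv (by norm_num)).comp (by fun_prop)).clm_apply
        continuous_const).clm_apply continuous_const).const_smul ε
    have hσc' : ∀ i, Continuous fun y => fderiv ℝ σ y (b i) := fun i =>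
      (hσ.continuous_fderiv (by norm_num)).clm_apply continuous_const
    have hσs' : ∀ i, HasCompactSupport fun y => fderiv ℝ σ y (b i) := fun i =>
      hσc.fderiv_apply ℝ (b i)
    have hint1 : ∀ i, Integrable fun y => fderiv ℝ σ y (b i) • fderiv ℝ h (x + ε • y) (b i) :=
      fun i => ((hσc' i).smul (hGc i)).integrable_of_hasCompactSupport (hσs' i).smul_right
    have hint2 : ∀ i, Integrable fun y =>
        σ y • (ε • fderiv ℝ (fderiv ℝ h) (x + ε • y) (b i) (b i)) := fun i =>
      (hσ.continuous.smul (hGc' i)).integrable_of_hasCompactSupport hσc.smul_right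
    -- No boundary term, because σ has compact support. The factor ε comes from the chain rule.
    have hparts : ∀ i, ∫ y, fderiv ℝ σ y (b i) • fderiv ℝ h (x + ε • y) (b i) =
        -∫ y, σ y • (ε • fderiv ℝ (fderiv ℝ h) (x + ε • y) (b i) (b i)) := by
      intro i
      have := integral_bilinear_hasFDerivAt_right_eq_neg_left_of_integrable (μ := volume)
        (B := (ContinuousLinearMap.lsmul ℝ ℝ : ℝ →L[ℝ] F →L[ℝ] F)) (v := b i)
        (f := σ) (f' := fderiv ℝ σ) (g := fun y => fderiv ℝ h (x + ε • y) (b i))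
        (g' := fun y => ε • (fderiv ℝ (fderiv ℝ h) (x + ε • y)).flip (b i)) (hint1 i) (hint2 i)
        ((hσ.continuous.smul (hGc i)).integrable_of_hasCompactSupport hσc.smul_right)
        (fun y _ => (hσ.differentiable (by norm_num) y).hasFDerivAt) (fun y _ => hGd i y)
      rw [eq_comm, neg_eq_iff_eq_neg]
      exact this
    have hlap : ∀ z, ∑ i, fderiv ℝ (fderiv ℝ h) z (b i) (b i) = 0 := by
      intro z
      have h1 := (hh z (mem_univ z)).2.self_of_nhds
      rw [laplacian_eq_iteratedFDeriv_orthonormalBasis h b] at h1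
      simpa [iteratedFDeriv_two_apply] using h1
    rw [ContinuousLinearMap.integral_apply]
    · simp only [smul_apply, ContinuousLinearMap.comp_apply,
        ContinuousLinearMap.toSpanSingleton_apply, one_smul, hρσ]
      rw [integral_finsetSum (f := fun i y => -(fderiv ℝ σ y (b i) • fderiv ℝ h (x + ε • y) (b i)))
        _ fun i _ => (hint1 i).neg]
      simp only [integral_neg, hparts, neg_neg]
      rw [← integral_finsetSum _ fun i _ => hint2 i]
      simp [← Finset.smul_sum, hlap]
    · refine Continuous.integrable_of_hasCompactSupport (hρ.continuous.smul ?_) hρc.smul_right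
      exact (hC1.continuous.comp (by fun_prop)).clm_comp
        (ContinuousLinearMap.toSpanSingletonCLE (𝕜 := ℝ) (E := E)).continuous
  intro ε
  have := is_const_of_deriv_eq_zero (fun ε => (hzero ε).differentiableAt)
    (fun ε => (hzero ε).deriv) ε 0
  rw [this]
  simp [integral_smul_const, hI]

end MeanValue

end

/-! ### Smoothness and factorial derivative bounds from the mean value property. -/

section

open MeasureTheory Filter Topology Set InnerProductSpace
open scoped ContDiff Convolution Laplacian

section MeanValueEstimates

variable {E : Type*} [NormedAddCommGroup E] [InnerProductSpace ℝ E] [FiniteDimensional ℝ E]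
  [MeasurableSpace E] [BorelSpace E] {F : Type*} [NormedAddCommGroup F] [NormedSpace ℝ F]
  {ρ : E → ℝ} {h : E → F}

theorem HasMeanValue.convolution_eq (hm : HasMeanValue ρ h) :
    (ρ ⋆[ContinuousLinearMap.lsmul ℝ ℝ, volume] h) = h := by
  ext x
  -- The convolution evaluates `h` at `x - y`, which is the dilation ε = -1.
  rw [convolution_def, ← hm x (-1)]
  simp [sub_eq_add_neg]

theorem HasMeanValue.contDiff (hm : HasMeanValue ρ h) (hρ : ContDiff ℝ ∞ ρ)
    (hc : HasCompactSupport ρ) (hh : Continuous h) : ContDiff ℝ ∞ h := by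
  rw [← hm.convolution_eq]
  exact hc.contDiff_convolution_left _ hρ hh.locallyIntegrable

/-- Differentiation in `x` passes under the integral. This is what allows the gradient estimate to
be iterated. -/
theorem HasMeanValue.fderiv (hm : HasMeanValue ρ h) (hρ : Continuous ρ)
    (hc : HasCompactSupport ρ) (hh : ContDiff ℝ 1 h) : HasMeanValue ρ (fderiv ℝ h) := by
  intro x ε
  have h1 := hasFDerivAt_integral_smul_of_hasCompactSupport (μ := volume) hρ hc
    (k := fun x y => h (x + ε • y)) (k' := fun x y => _root_.fderiv ℝ h (x + ε • y))
    (fun p y => (hasFDerivAt_comp_add_right _).2 (hh.differentiable one_ne_zero _).hasFDerivAt)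
    (hh.continuous.comp (by fun_prop)) ((hh.continuous_fderiv one_ne_zero).comp (by fun_prop)) x
  have h2 : (fun x => ∫ y, ρ y • h (x + ε • y)) = h := funext fun x => hm x ε
  rw [h2] at h1
  exact h1.fderiv.symm

theorem HasMeanValue.comp_smul (hm : HasMeanValue ρ h) (δ : ℝ) :
    HasMeanValue ρ fun x => h (δ • x) := by
  intro x ε
  simp only [smul_add, smul_smul]
  exact hm _ _

/-- Since h = ρ ⋆ h, the derivative can be put on ρ, whose support confines the values of `h` to the
unit ball about `x`. -/
theorem HasMeanValue.norm_fderiv_le_of_unit (hm : HasMeanValue ρ h) (hρ : ContDiff ℝ ∞ ρ)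
    (hρ1 : tsupport ρ ⊆ Metric.closedBall 0 1) (hc : HasCompactSupport ρ) (hh : Continuous h)
    {x : E} {M : ℝ} (hM : ∀ z ∈ Metric.closedBall x 1, ‖h z‖ ≤ M) :
    ‖_root_.fderiv ℝ h x‖ ≤ (∫ y, ‖_root_.fderiv ℝ ρ y‖) * M := by
  have h1 := hc.hasFDerivAt_convolution_left (ContinuousLinearMap.lsmul ℝ ℝ : ℝ →L[ℝ] F →L[ℝ] F)
    (hρ.of_le (by simp)) (hh.locallyIntegrable (μ := volume)) x
  rw [hm.convolution_eq] at h1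
  rw [h1.fderiv, convolution_def, ← integral_mul_const]
  have hint : Integrable fun y => ‖_root_.fderiv ℝ ρ y‖ :=
    ((hρ.continuous_fderiv (by simp)).integrable_of_hasCompactSupport (hc.fderiv ℝ)).norm
  refine norm_integral_le_of_norm_le (hint.mul_const M) (Eventually.of_forall fun t => ?_)
  by_cases ht : t ∈ tsupport ρ
  · have h2 : x - t ∈ Metric.closedBall x 1 := by
      have := hρ1 ht
      simpa [dist_eq_norm] using this
    refine le_trans ?_ (mul_le_mul_of_nonneg_left (hM _ h2) (norm_nonneg _))
    refine ContinuousLinearMap.opNorm_le_bound _ (by positivity) fun v => ?_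
    rw [ContinuousLinearMap.precompL_apply, ContinuousLinearMap.lsmul_apply, norm_smul]
    calc _ ≤ ‖_root_.fderiv ℝ ρ t‖ * ‖v‖ * ‖h (x - t)‖ :=
          mul_le_mul_of_nonneg_right (ContinuousLinearMap.le_opNorm _ _) (norm_nonneg _)
      _ = _ := by ring
  · have h3 : _root_.fderiv ℝ ρ t = 0 := by
      by_contra h4
      exact ht (support_fderiv_subset ℝ h4)
    simp [h3]

theorem HasMeanValue.norm_fderiv_le (hm : HasMeanValue ρ h) (hρ : ContDiff ℝ ∞ ρ)
    (hρ1 : tsupport ρ ⊆ Metric.closedBall 0 1) (hc : HasCompactSupport ρ) (hh : Continuous h)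
    {x : E} {M ε : ℝ} (hε : 0 < ε) (hM : ∀ z ∈ Metric.closedBall x ε, ‖h z‖ ≤ M) :
    ‖_root_.fderiv ℝ h x‖ ≤ (∫ y, ‖_root_.fderiv ℝ ρ y‖) / ε * M := by
  have h1 := (hm.comp_smul ε).norm_fderiv_le_of_unit hρ hρ1 hc (x := ε⁻¹ • x) (M := M)
    (hh.comp (continuous_const_smul ε)) (by
      intro z hz
      refine hM _ ?_
      rw [mem_closedBall_iff_norm] at hz ⊢
      have : ε • z - x = ε • (z - ε⁻¹ • x) := by
        rw [smul_sub, smul_smul, mul_inv_cancel₀ hε.ne', one_smul]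
      rw [this, norm_smul, Real.norm_of_nonneg hε.le]
      nlinarith)
  rw [fderiv_comp_smul, norm_smul, smul_smul, mul_inv_cancel₀ hε.ne', one_smul,
    Real.norm_of_nonneg hε.le] at h1
  rw [div_mul_eq_mul_div, le_div_iff₀ hε]
  linarith

end MeanValueEstimates

section IteratedEstimates

universe u

variable {E : Type u} [NormedAddCommGroup E] [InnerProductSpace ℝ E] [FiniteDimensional ℝ E]
  [MeasurableSpace E] [BorelSpace E] {ρ : E → ℝ}

/-- Each derivative costs a factor C/ε and a shrinking of the ball by ε. The value space is
quantified inside the induction because the step passes from `h` to `fderiv ℝ h`. -/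
theorem HasMeanValue.norm_iteratedFDeriv_le (hρ : ContDiff ℝ ∞ ρ)
    (hρ1 : tsupport ρ ⊆ Metric.closedBall 0 1) (hc : HasCompactSupport ρ) {ε : ℝ} (hε : 0 < ε)
    (k : ℕ) : ∀ {F : Type u} [NormedAddCommGroup F] [NormedSpace ℝ F] {h : E → F},
    HasMeanValue ρ h → Continuous h → ∀ {x : E} {M : ℝ},
    (∀ z ∈ Metric.closedBall x (k * ε), ‖h z‖ ≤ M) →
    ‖iteratedFDeriv ℝ k h x‖ ≤ ((∫ y, ‖_root_.fderiv ℝ ρ y‖) / ε) ^ k * M := by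
  induction k with
  | zero => 
    intro F _ _ h hm hh x M hM
    simpa using hM x (by simp)
  | succ k ih =>
    intro F _ _ h hm hh x M hM
    have hs := hm.contDiff hρ hc hh
    rw [← norm_iteratedFDeriv_fderiv, pow_succ, mul_assoc]
    refine ih (hm.fderiv hρ.continuous hc (hs.of_le (by simp)))
      (hs.continuous_fderiv (by simp)) fun z hz => ?_
    refine hm.norm_fderiv_le hρ hρ1 hc hh hε fun w hw => hM w ?_
    rw [Metric.mem_closedBall] at *
    push_cast
    linarith [dist_triangle w z x]

theorem norm_iteratedFDeriv_le_factorial_of_harmonic {F : Type u} [NormedAddCommGroup F]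
    [NormedSpace ℝ F] [CompleteSpace F] {h : E → F} (hh : HarmonicOnNhd h univ) (x₀ : E) :
    ContDiff ℝ ∞ h ∧ ∃ A M : ℝ, 0 < A ∧ 0 ≤ M ∧ ∀ k : ℕ, ∀ x ∈ Metric.closedBall x₀ 1,
      ‖iteratedFDeriv ℝ k h x‖ ≤ M * A ^ k * k.factorial := by
  obtain ⟨ρ, σ, hρ, hσ, hρ1, hσ1, hI, hσρ⟩ := exists_radial_kernel (E := E)
  have hm := hasMeanValue_of_harmonic hρ hσ hρ1 hσ1 hI hσρ hh
  have hcont : Continuous h := (contDiffOn_univ.1 hh.contDiffOn).continuous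
  have hsupp : tsupport ρ ⊆ Metric.closedBall 0 1 := by
    refine closure_minimal (fun y hy => ?_) Metric.isClosed_closedBall
    by_contra hy'
    refine hy (hρ1 y ?_)
    simp at hy'; exact hy'.le
  have hc : HasCompactSupport ρ :=
    (isCompact_closedBall (0 : E) 1).of_isClosed_subset (isClosed_tsupport ρ) hsupp
  refine ⟨hm.contDiff hρ hc hcont, ?_⟩
  obtain ⟨M, hM⟩ := (isCompact_closedBall x₀ 2).exists_bound_of_continuousOn hcont.continuousOn
  have hM0 : 0 ≤ M := (norm_nonneg _).trans (hM x₀ (by simp))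
  set C := ∫ y, ‖fderiv ℝ ρ y‖ with hC
  have hC0 : 0 ≤ C := integral_nonneg fun _ => norm_nonneg _
  refine ⟨(C + 1) * Real.exp 1, M, by positivity, hM0, fun k x hx => ?_⟩
  rcases Nat.eq_zero_or_pos k with rfl | hk
  · simpa using hM x (Metric.closedBall_subset_closedBall (by norm_num) hx)
  have hk' : (0 : ℝ) < k := by exact_mod_cast hk
  -- With ε = 1/k the k steps use up radius exactly 1 and stay in the ball of radius 2 on which M is
  -- a bound. The resulting (Ck)^k is of factorial size because k^k ≤ e^k k!.
  have h1 := HasMeanValue.norm_iteratedFDeriv_le hρ hsupp hc (inv_pos.2 hk') k hm hcont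
    (x := x) (M := M) fun z hz => hM z (by
      rw [mul_inv_cancel₀ hk'.ne'] at hz
      rw [Metric.mem_closedBall] at *
      linarith [dist_triangle z x x₀])
  refine h1.trans ?_
  have h2 : (k : ℝ) ^ k ≤ Real.exp 1 ^ k * k.factorial := by
    have := Real.pow_div_factorial_le_exp (k : ℝ) hk'.le k
    rw [div_le_iff₀ (by positivity)] at this
    rwa [← Real.exp_nat_mul, mul_one]
  rw [← hC, div_inv_eq_mul, mul_pow, mul_pow]
  calc C ^ k * (k : ℝ) ^ k * M ≤ (C + 1) ^ k * (Real.exp 1 ^ k * k.factorial) * M := by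
        gcongr; linarith
    _ = _ := by ring

end IteratedEstimates

end

/-! ### Holomorphic extension by complexifying the Taylor series. -/

section

open MeasureTheory Filter Topology Set InnerProductSpace
open scoped ContDiff

section Complexification

variable {m : ℕ}

/-- The inclusion of `ℝ^m` in `ℂ^m`. -/
def realInclusion (m : ℕ) : EuclideanSpace ℝ (Fin m) →L[ℝ] (Fin m → ℂ) :=
  ContinuousLinearMap.pi fun k => Complex.ofRealCLM ∘L EuclideanSpace.proj k

theorem realInclusion_apply (x : EuclideanSpace ℝ (Fin m)) :
    realInclusion m x = fun k => (x k : ℂ) := rfl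

theorem norm_le_mul_norm_realInclusion (y : EuclideanSpace ℝ (Fin m)) :
    ‖y‖ ≤ m * ‖realInclusion m y‖ := by
  have h1 : y = ∑ i, y i • EuclideanSpace.single i (1 : ℝ) := by
    ext j
    simp [Finset.sum_apply, Pi.single_apply]
  calc ‖y‖ = ‖∑ i, y i • EuclideanSpace.single i (1 : ℝ)‖ := by rw [← h1]
    _ ≤ ∑ i, ‖y i • EuclideanSpace.single i (1 : ℝ)‖ := norm_sum_le _ _
    _ ≤ ∑ _i : Fin m, ‖realInclusion m y‖ := by
        refine Finset.sum_le_sum fun i _ => ?_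
        rw [norm_smul, PiLp.norm_single, norm_one, mul_one]
        have := norm_le_pi_norm (realInclusion m y) i
        simpa [realInclusion_apply] using this
    _ = _ := by simp

/-- The `ℂ`-multilinear extension of an `ℝ`-multilinear map. -/
def complexify {k : ℕ} (f : EuclideanSpace ℝ (Fin m) [×k]→L[ℝ] ℂ) : (Fin m → ℂ) [×k]→L[ℂ] ℂ :=
  ∑ α : Fin k → Fin m, f (fun j => EuclideanSpace.single (α j) 1) •
    (ContinuousMultilinearMap.mkPiAlgebraFin ℂ k ℂ).compContinuousLinearMap
      fun j => ContinuousLinearMap.proj (α j)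

theorem complexify_realInclusion {k : ℕ} (f : EuclideanSpace ℝ (Fin m) [×k]→L[ℝ] ℂ)
    (y : EuclideanSpace ℝ (Fin m)) :
    complexify f (fun _ => realInclusion m y) = f fun _ => y := by
  have h1 : y = ∑ i, y i • EuclideanSpace.single i (1 : ℝ) := by
    ext j
    simp [Finset.sum_apply, Pi.single_apply]
  conv_rhs => rw [h1]
  have h2 := f.map_sum (fun (_ : Fin k) (i : Fin m) => y i • EuclideanSpace.single i (1 : ℝ))
  rw [h2]
  simp only [complexify, sum_apply]
  refine Finset.sum_congr rfl fun α _ => ?_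
  have h3 := f.map_smul_univ (fun j => y (α j)) fun j => EuclideanSpace.single (α j) (1 : ℝ)
  rw [h3]
  simp [realInclusion_apply, List.prod_ofFn, mul_comm]

/-- There are m^k multi-indices, and each contributes a product of coordinates, of norm at most 1,
times a value of f on unit vectors. -/
theorem norm_complexify_le {k : ℕ} (f : EuclideanSpace ℝ (Fin m) [×k]→L[ℝ] ℂ) :
    ‖complexify f‖ ≤ m ^ k * ‖f‖ := by
  have h1 : ∀ α : Fin k → Fin m, ‖f (fun j => EuclideanSpace.single (α j) 1) •
      (ContinuousMultilinearMap.mkPiAlgebraFin ℂ k ℂ).compContinuousLinearMap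
      (fun j => (ContinuousLinearMap.proj (α j) : (Fin m → ℂ) →L[ℂ] ℂ))‖ ≤ ‖f‖ := by
    intro α
    rw [norm_smul]
    have h2 : ‖f (fun j => EuclideanSpace.single (α j) 1)‖ ≤ ‖f‖ := by
      refine (f.le_opNorm _).trans ?_
      simp
    have h3 : ‖(ContinuousMultilinearMap.mkPiAlgebraFin ℂ k ℂ).compContinuousLinearMap
        (fun j => (ContinuousLinearMap.proj (α j) : (Fin m → ℂ) →L[ℂ] ℂ))‖ ≤ 1 := by
      refine ContinuousMultilinearMap.opNorm_le_bound zero_le_one fun v => ?_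
      simp only [ContinuousMultilinearMap.compContinuousLinearMap_apply,
        ContinuousMultilinearMap.mkPiAlgebraFin_apply, List.prod_ofFn, norm_prod, one_mul]
      exact Finset.prod_le_prod (fun _ _ => norm_nonneg _) fun j _ => norm_le_pi_norm (v j) (α j)
    exact (mul_le_mul h2 h3 (norm_nonneg _) (norm_nonneg _)).trans_eq (mul_one _)
  refine (norm_sum_le _ _).trans ((Finset.sum_le_sum fun α _ => h1 α).trans ?_)
  simp

theorem tendsto_taylor_of_norm_iteratedFDeriv_le {E : Type*} [NormedAddCommGroup E]
    [NormedSpace ℝ E] {F : Type*} [NormedAddCommGroup F] [NormedSpace ℝ F] [CompleteSpace F]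
    {h : E → F} (hs : ContDiff ℝ ∞ h) {x₀ : E} {A M : ℝ} (hA : 0 < A)
    (hb : ∀ k : ℕ, ∀ x ∈ Metric.closedBall x₀ 1, ‖iteratedFDeriv ℝ k h x‖ ≤ M * A ^ k * k.factorial)
    {y : E} (hy1 : ‖y‖ ≤ 1) (hyA : A * ‖y‖ < 1) :
    Tendsto (fun n => ∑ k ∈ Finset.range (n + 1),
      (k.factorial : ℝ)⁻¹ • iteratedFDeriv ℝ k h x₀ fun _ => y) atTop (𝓝 (h (x₀ + y))) := by
  -- The integral remainder carries 1/n! against the bound with (n+1)!, leaving the harmless factor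
  -- n + 1 before a geometric term.
  have hlim : Tendsto (fun n : ℕ => M * (((n + 1 : ℕ) : ℝ) * (A * ‖y‖) ^ (n + 1))) atTop (𝓝 0) := by
    have := (tendsto_self_mul_const_pow_of_lt_one (by positivity) hyA).comp (tendsto_add_atTop_nat 1)
    simpa using this.const_mul M
  rw [tendsto_iff_norm_sub_tendsto_zero]
  refine squeeze_zero (fun _ => norm_nonneg _) (fun n => ?_) hlim
  rw [map_add_eq_sum_add_integral_iteratedFDeriv (n := n)
    fun t _ => (hs.of_le (by exact_mod_cast le_top)).contDiffAt]
  rw [sub_add_cancel_left, norm_neg, norm_smul]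
  have h1 : ‖∫ t in (0 : ℝ)..1, (1 - t) ^ n • iteratedFDeriv ℝ (n + 1) h (x₀ + t • y) fun _ => y‖ ≤
      M * A ^ (n + 1) * (n + 1).factorial * ‖y‖ ^ (n + 1) * |1 - 0| := by
    refine intervalIntegral.norm_integral_le_of_norm_le_const fun t ht => ?_
    rw [uIoc_of_le zero_le_one] at ht
    rw [norm_smul, norm_pow, Real.norm_of_nonneg (by linarith [ht.2])]
    have h2 : (1 - t) ^ n ≤ 1 := pow_le_one₀ (by linarith [ht.2]) (by linarith [ht.1])
    have h3 : ‖iteratedFDeriv ℝ (n + 1) h (x₀ + t • y) fun _ => y‖ ≤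
        M * A ^ (n + 1) * (n + 1).factorial * ‖y‖ ^ (n + 1) := by
      refine (ContinuousMultilinearMap.le_opNorm _ _).trans ?_
      simp only [Finset.prod_const, Finset.card_univ, Fintype.card_fin]
      refine mul_le_mul_of_nonneg_right (hb _ _ ?_) (by positivity)
      rw [mem_closedBall_iff_norm, add_sub_cancel_left, norm_smul, Real.norm_of_nonneg ht.1.le]
      exact mul_le_one₀ ht.2 (norm_nonneg _) hy1
    calc _ ≤ 1 * (M * A ^ (n + 1) * (n + 1).factorial * ‖y‖ ^ (n + 1)) :=
          mul_le_mul h2 h3 (norm_nonneg _) zero_le_one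
      _ = _ := one_mul _
  have hn : (n.factorial : ℝ) ≠ 0 := by positivity
  rw [norm_inv, RCLike.norm_natCast]
  calc _ ≤ (n.factorial : ℝ)⁻¹ * (M * A ^ (n + 1) * (n + 1).factorial * ‖y‖ ^ (n + 1) * |1 - 0|) :=
        mul_le_mul_of_nonneg_left h1 (by positivity)
    _ = _ := by
        rw [Nat.factorial_succ]
        push_cast
        field_simp
        simp [mul_pow, mul_assoc]

/-- A harmonic function on `ℝ^m` extends holomorphically to a neighbourhood of any real point. -/
theorem exists_holomorphic_extension_of_harmonic {h : EuclideanSpace ℝ (Fin m) → ℂ}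
    (hh : HarmonicOnNhd h univ) (x₀ : EuclideanSpace ℝ (Fin m)) :
    ∃ R > 0, ∃ H : (Fin m → ℂ) → ℂ, AnalyticOnNhd ℂ H (Metric.ball (realInclusion m x₀) R) ∧
      ∀ x, realInclusion m x ∈ Metric.ball (realInclusion m x₀) R → H (realInclusion m x) = h x := by
  obtain ⟨hs, A, M, hA, hM, hb⟩ := norm_iteratedFDeriv_le_factorial_of_harmonic hh x₀
  let p : FormalMultilinearSeries ℂ (Fin m → ℂ) ℂ := fun k =>
    (k.factorial : ℂ)⁻¹ • complexify (iteratedFDeriv ℝ k h x₀)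
  have hp : ∀ k, ‖p k‖ ≤ M * (m * A) ^ k := by
    intro k
    have hk : (0 : ℝ) < k.factorial := by positivity
    simp only [p, norm_smul, norm_inv, RCLike.norm_natCast]
    rw [inv_mul_le_iff₀ hk]
    refine (norm_complexify_le _).trans ?_
    calc (m : ℝ) ^ k * ‖iteratedFDeriv ℝ k h x₀‖ ≤ m ^ k * (M * A ^ k * k.factorial) :=
          mul_le_mul_of_nonneg_left (hb k x₀ (by simp)) (by positivity)
      _ = _ := by ring
  -- This radius serves three purposes: mAR ≤ 1 for the complex power series, and mR ≤ 1 and A·mR <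
  -- 1 for the real Taylor expansion, where ‖y‖ ≤ mR by comparison of the Euclidean and sup norms.
  set R : ℝ := (m * (A + 1) + 1)⁻¹ with hR
  have hR0 : 0 < R := by positivity
  have hmR : m * (A + 1) * R < 1 := by
    rw [hR, ← div_eq_mul_inv, div_lt_one (by positivity)]; linarith
  have hmR0 : 0 ≤ m * R := by positivity
  have hrad : (R.toNNReal : ENNReal) ≤ p.radius := by
    refine p.le_radius_of_bound M fun k => ?_
    rw [Real.coe_toNNReal _ hR0.le]
    calc ‖p k‖ * R ^ k ≤ M * (m * A) ^ k * R ^ k :=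
          mul_le_mul_of_nonneg_right (hp k) (by positivity)
      _ = M * (m * A * R) ^ k := by rw [mul_assoc, ← mul_pow]
      _ ≤ M * 1 := by
          refine mul_le_mul_of_nonneg_left (pow_le_one₀ (by positivity) ?_) hM
          nlinarith
      _ = M := mul_one M
  have hpos : 0 < p.radius := lt_of_lt_of_le (by simpa using hR0) hrad
  have hps := (p.hasFPowerSeriesOnBall hpos).comp_sub (realInclusion m x₀)
  rw [zero_add] at hps
  have hball : Metric.ball (realInclusion m x₀) R ⊆ Metric.eball (realInclusion m x₀) p.radius := by
    intro z hz
    refine Metric.eball_subset_eball hrad ?_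
    simpa [← Metric.eball_ofReal] using hz
  refine ⟨R, hR0, fun z => p.sum (z - realInclusion m x₀),
    hps.analyticOnNhd.mono hball, fun x hx => ?_⟩
  set y := x - x₀ with hy
  have hyR : ‖realInclusion m y‖ < R := by
    rw [hy, map_sub]; exact mem_ball_iff_norm.1 hx
  have hyn : ‖y‖ ≤ m * R := (norm_le_mul_norm_realInclusion y).trans (by gcongr)
  have h1 := tendsto_taylor_of_norm_iteratedFDeriv_le hs hA hb (y := y) (by nlinarith)
    (lt_of_le_of_lt (mul_le_mul_of_nonneg_left hyn hA.le) (by nlinarith))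
  have h2 : HasSum (fun k => p k fun _ => realInclusion m y) (p.sum (realInclusion m y)) := by
    refine p.hasSum (Metric.eball_subset_eball hrad ?_)
    rw [← ENNReal.ofReal, Metric.eball_ofReal]
    simpa using hyR
  have h3 := h2.tendsto_sum_nat.comp (tendsto_add_atTop_nat 1)
  change p.sum (realInclusion m x - realInclusion m x₀) = h x
  rw [← map_sub]
  have h4 : x₀ + y = x := by simp [hy]
  rw [h4] at h1
  refine tendsto_nhds_unique h3 (h1.congr fun n => ?_)
  refine Finset.sum_congr rfl fun k _ => ?_
  simp only [p, smul_apply, complexify_realInclusion]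
  rw [← Complex.coe_smul]
  push_cast
  rfl

end Complexification

end

/-! ### An identity theorem for holomorphic functions on non-open sets. -/

section

open MeasureTheory Filter Topology Set InnerProductSpace
open scoped ContDiff Laplacian

section Identity

universe u

variable {E : Type u} [NormedAddCommGroup E] [NormedSpace ℂ E]

/-- The velocities at `x` of the curves in `S` through `x`. -/
def velocities (S : Set E) (x : E) : Set E :=
  {v | ∃ γ : ℝ → E, γ 0 = x ∧ HasDerivAt γ v 0 ∧ ∀ᶠ t in 𝓝 0, γ t ∈ S}

/-- The derivative kills the velocity of every curve in S, since K is zero along it, and being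
ℂ-linear it kills their complex span. -/
theorem fderiv_eq_zero_of_span_velocities {F : Type u} [NormedAddCommGroup F] [NormedSpace ℂ F]
    {S : Set E} {x : E} (hS : Submodule.span ℂ (velocities S x) = ⊤) {K : E → F}
    (hK : DifferentiableAt ℂ K x) (h0 : ∀ x ∈ S, K x = 0) : fderiv ℂ K x = 0 := by
  have h1 : ∀ v ∈ velocities S x, fderiv ℂ K x v = 0 := by
    rintro v ⟨γ, rfl, hγ, hγS⟩
    have h2 := (hK.hasFDerivAt.restrictScalars ℝ).comp_hasDerivAt (0 : ℝ) hγ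
    have h3 : K ∘ γ =ᶠ[𝓝 0] fun _ => 0 := hγS.mono fun t ht => h0 _ ht
    exact (h2.congr_of_eventuallyEq h3.symm).unique (hasDerivAt_const (0 : ℝ) (0 : F))
  ext v
  have hv : v ∈ Submodule.span ℂ (velocities S x) := hS ▸ Submodule.mem_top
  induction hv using Submodule.span_induction with
  | mem v hv => exact h1 v hv
  | zero => simp
  | add v w _ _ hv hw => simp [hv, hw]
  | smul c v _ hv => simp [hv]

/-- The previous lemma makes `fderiv ℂ K` vanish on all of S, so the same argument applies to it. -/
theorem iteratedFDeriv_eq_zero_of_span_velocities {S : Set E}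
    (hS : ∀ x ∈ S, Submodule.span ℂ (velocities S x) = ⊤) (k : ℕ) :
    ∀ {F : Type u} [NormedAddCommGroup F] [NormedSpace ℂ F] [CompleteSpace F] {K : E → F},
    AnalyticOnNhd ℂ K S → (∀ x ∈ S, K x = 0) → ∀ x ∈ S, iteratedFDeriv ℂ k K x = 0 := by
  induction k with
  | zero =>
    intro F _ _ _ K _ h0 x hx
    ext
    simp [h0 x hx]
  | succ k ih =>
    intro F _ _ _ K hK h0 x hx
    rw [← norm_eq_zero, ← norm_iteratedFDeriv_fderiv, norm_eq_zero]
    exact ih hK.fderiv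
      (fun x hx => fderiv_eq_zero_of_span_velocities (hS x hx) (hK x hx).differentiableAt h0) x hx

/-- **Identity theorem** on sets whose velocities span the ambient complex space. -/
theorem eventuallyEq_zero_of_span_velocities {F : Type u} [NormedAddCommGroup F]
    [NormedSpace ℂ F] [CompleteSpace F] {S : Set E}
    (hS : ∀ x ∈ S, Submodule.span ℂ (velocities S x) = ⊤) {K : E → F} (hK : AnalyticOnNhd ℂ K S)
    (h0 : ∀ x ∈ S, K x = 0) {x : E} (hx : x ∈ S) : K =ᶠ[𝓝 x] 0 := by
  obtain ⟨p, r, hp⟩ := hK x hx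
  filter_upwards [Metric.eball_mem_nhds x hp.r_pos] with z hz
  have h1 := hp.hasSum_iteratedFDeriv (y := z - x) (by
    rwa [Metric.mem_eball, edist_eq_enorm_sub, sub_zero, ← edist_eq_enorm_sub])
  simp only [iteratedFDeriv_eq_zero_of_span_velocities hS _ hK h0 x hx] at h1
  simpa using h1.unique (by simp)

/-- The hypothesis is a complex bilinear, not Hermitian, tight-frame identity. It still reproduces z
as c⁻¹ ∑ (z·w_i) w_i. -/
theorem span_range_eq_top_of_sum_mul {ι : Type*} [Fintype ι] {m : ℕ} {w : ι → Fin m → ℂ} {c : ℂ}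
    (hc : c ≠ 0) (hw : ∀ k l, ∑ i, w i k * w i l = if k = l then c else 0) :
    Submodule.span ℂ (range w) = ⊤ := by
  rw [eq_top_iff]
  intro z _
  have h1 : z = ∑ i, (c⁻¹ * ∑ k, z k * w i k) • w i := by
    ext l
    simp only [Finset.sum_apply, Pi.smul_apply, smul_eq_mul, Finset.mul_sum, Finset.sum_mul]
    rw [Finset.sum_comm]
    have : ∀ k, ∑ i, c⁻¹ * (z k * w i k) * w i l = c⁻¹ * z k * (if k = l then c else 0) := by
      intro k
      rw [← hw, Finset.mul_sum]
      exact Finset.sum_congr rfl fun i _ => by ring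
    simp [this]
    field_simp
  rw [h1]
  exact Submodule.sum_mem _ fun i _ => Submodule.smul_mem _ _ (Submodule.subset_span ⟨i, rfl⟩)

end Identity

/-! ### Transfer between the real points of ℂ^m and the connected domain U. -/

section RealPoints

variable {m : ℕ}

theorem realInclusion_single (k : Fin m) :
    realInclusion m (EuclideanSpace.single k 1) = Pi.single k 1 := by
  ext j
  by_cases hj : j = k <;> simp [realInclusion_apply, hj]

theorem span_velocities_realInclusion {O : Set (EuclideanSpace ℝ (Fin m))} (hO : IsOpen O) :
    ∀ z ∈ realInclusion m '' O,
      Submodule.span ℂ (velocities (realInclusion m '' O) z) = ⊤ := by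
  rintro _ ⟨x, hx, rfl⟩
  rw [eq_top_iff, ← (Pi.basisFun ℂ (Fin m)).span_eq]
  refine Submodule.span_mono ?_
  rintro _ ⟨k, rfl⟩
  refine ⟨fun t => realInclusion m (x + t • EuclideanSpace.single k 1), by simp, ?_, ?_⟩
  · have h1 : HasDerivAt (fun t : ℝ => x + t • EuclideanSpace.single k (1 : ℝ))
        ((1 : ℝ) • EuclideanSpace.single k (1 : ℝ)) 0 :=
      ((hasDerivAt_id (0 : ℝ)).smul_const _).const_add x
    have h2 := (realInclusion m).hasFDerivAt.comp_hasDerivAt (0 : ℝ) h1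
    rw [one_smul, realInclusion_single] at h2
    rwa [Pi.basisFun_apply]
  · have h1 : Continuous fun t : ℝ => x + t • EuclideanSpace.single k (1 : ℝ) := by fun_prop
    filter_upwards [h1.continuousAt.preimage_mem_nhds (hO.mem_nhds (by simpa using hx))] with t ht
    exact ⟨_, ht, rfl⟩

/-- Needed to spread the vanishing of `h` from a small ball to the whole of ℝ^m. -/
theorem analyticOnNhd_of_harmonic {h : EuclideanSpace ℝ (Fin m) → ℂ}
    (hh : HarmonicOnNhd h univ) : AnalyticOnNhd ℝ h univ := by
  intro x _
  obtain ⟨R, hR, H, hH, hHh⟩ := exists_holomorphic_extension_of_harmonic hh x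
  have h1 : AnalyticAt ℝ (H ∘ realInclusion m) x :=
    (hH _ (Metric.mem_ball_self hR)).restrictScalars.comp ((realInclusion m).analyticAt x)
  refine h1.congr ?_
  filter_upwards [(realInclusion m).continuous.continuousAt.preimage_mem_nhds
    (Metric.ball_mem_nhds _ hR)] with z hz
  exact hHh z hz

/-- The complex Laplacian `∑ ∂²H/∂z_k²`. -/
def complexLaplacian (H : (Fin m → ℂ) → ℂ) (z : Fin m → ℂ) : ℂ :=
  ∑ k, fderiv ℂ (fun w => fderiv ℂ H w (Pi.single k 1)) z (Pi.single k 1)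

variable {h : EuclideanSpace ℝ (Fin m) → ℂ} {U : Set (Fin m → ℂ)} {H : (Fin m → ℂ) → ℂ}

theorem _root_.AnalyticOnNhd.fderiv_apply_const (hH : AnalyticOnNhd ℂ H U) (v : Fin m → ℂ) :
    AnalyticOnNhd ℂ (fun w => fderiv ℂ H w v) U :=
  (ContinuousLinearMap.apply ℂ ℂ v).comp_analyticOnNhd hH.fderiv

theorem analyticOnNhd_complexLaplacian (hH : AnalyticOnNhd ℂ H U) :
    AnalyticOnNhd ℂ (complexLaplacian H) U :=
  Finset.univ.analyticOnNhd_fun_sum fun k _ =>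
    (hH.fderiv_apply_const (Pi.single k 1)).fderiv_apply_const (Pi.single k 1)

theorem fderiv_single_of_eventuallyEq {x : EuclideanSpace ℝ (Fin m)}
    (hH : DifferentiableAt ℂ H (realInclusion m x))
    (he : ∀ᶠ z in 𝓝 x, H (realInclusion m z) = h z) (k : Fin m) :
    fderiv ℝ h x (EuclideanSpace.single k 1) =
      fderiv ℂ H (realInclusion m x) (Pi.single k 1) := by
  have h1 := (hH.hasFDerivAt.restrictScalars ℝ).comp x (realInclusion m).hasFDerivAt
  have h2 : h =ᶠ[𝓝 x] H ∘ realInclusion m := he.mono fun z hz => hz.symm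
  rw [(h1.congr_of_eventuallyEq h2).fderiv, ← realInclusion_single]
  rfl

/-- At real points near x₀ the complex Laplacian of H is the Laplacian of h. The identity theorem
makes it vanish near x₀, and connectedness of U does the rest. -/
theorem IsExtensionReal.complexLaplacian_eq_zero (hE : IsExtensionReal h U H)
    (hh : HarmonicOnNhd h univ) : ∀ z ∈ U, complexLaplacian H z = 0 := by
  obtain ⟨x₀, hx₀, he⟩ := hE.agree
  change realInclusion m x₀ ∈ U at hx₀
  change ∀ᶠ x in 𝓝 x₀, H (realInclusion m x) = h x at he
  have hU : ∀ᶠ x in 𝓝 x₀, realInclusion m x ∈ U :=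
    (realInclusion m).continuous.continuousAt.preimage_mem_nhds (hE.isOpen.mem_nhds hx₀)
  obtain ⟨O, hO, hOo, hxO⟩ := eventually_nhds_iff.1 (he.and hU)
  have hC2 : ContDiff ℝ 2 h := contDiffOn_univ.1 hh.contDiffOn
  have hC1 : ContDiff ℝ 1 (fderiv ℝ h) := hC2.fderiv_right (by norm_num)
  have h0 : ∀ z ∈ realInclusion m '' O, complexLaplacian H z = 0 := by
    rintro _ ⟨x, hx, rfl⟩
    have h1 := (hh x (mem_univ x)).2.self_of_nhds
    rw [laplacian_eq_iteratedFDeriv_orthonormalBasis h (EuclideanSpace.basisFun (Fin m) ℝ)] at h1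
    simp only [iteratedFDeriv_two_apply, EuclideanSpace.basisFun_apply, Matrix.cons_val_zero,
      Matrix.cons_val_one, Pi.zero_apply] at h1
    rw [← h1]
    refine Finset.sum_congr rfl fun k _ => ?_
    have hk : ∀ y ∈ O, fderiv ℂ H (realInclusion m y) (Pi.single k 1) =
        fderiv ℝ h y (EuclideanSpace.single k 1) := fun y hy =>
      (fderiv_single_of_eventuallyEq (hE.analytic _ (hO y hy).2).differentiableAt
        (mem_of_superset (hOo.mem_nhds hy) fun z hz => (hO z hz).1) k).symm
    rw [← fderiv_single_of_eventuallyEq (h := fun y => fderiv ℝ h y (EuclideanSpace.single k 1))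
      ((hE.analytic.fderiv_apply_const _) _ (hO x hx).2).differentiableAt
      (mem_of_superset (hOo.mem_nhds hx) hk) k]
    rw [fderiv_clm_apply (hC1.differentiable (by norm_num) x) (differentiableAt_const _)]
    simp
  have h2 := eventuallyEq_zero_of_span_velocities (span_velocities_realInclusion hOo)
    ((analyticOnNhd_complexLaplacian hE.analytic).mono (by
      rintro _ ⟨x, hx, rfl⟩; exact (hO x hx).2)) h0 ⟨x₀, hxO, rfl⟩
  exact (analyticOnNhd_complexLaplacian hE.analytic).eqOn_zero_of_preconnected_of_eventuallyEq_zero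
    hE.isPreconnected hx₀ h2

theorem IsExtensionReal.eq_zero_of_eventuallyEq_zero (hE : IsExtensionReal h U H)
    (hh : HarmonicOnNhd h univ) {z : Fin m → ℂ} (hz : z ∈ U) (h0 : H =ᶠ[𝓝 z] 0) : h = 0 := by
  obtain ⟨x₀, hx₀, he⟩ := hE.agree
  change realInclusion m x₀ ∈ U at hx₀
  change ∀ᶠ x in 𝓝 x₀, H (realInclusion m x) = h x at he
  have h1 := hE.analytic.eqOn_zero_of_preconnected_of_eventuallyEq_zero hE.isPreconnected hz h0
  have hU : ∀ᶠ x in 𝓝 x₀, realInclusion m x ∈ U :=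
    (realInclusion m).continuous.continuousAt.preimage_mem_nhds (hE.isOpen.mem_nhds hx₀)
  have h2 : h =ᶠ[𝓝 x₀] 0 := by
    filter_upwards [he, hU] with x hx hxU
    rw [← hx, h1 hxU]
    rfl
  exact funext fun x => (analyticOnNhd_of_harmonic hh).eqOn_zero_of_preconnected_of_eventuallyEq_zero
    isPreconnected_univ (mem_univ x₀) h2 (mem_univ x)

end RealPoints

end

/-! ### The stereographic chart centred at a point of the sphere. -/

section

open Filter Topology Set InnerProductSpace
open scoped ContDiff Manifold

section Chart

variable {n : ℕ}

/-- The curve `t ↦ (t² + 4)⁻¹ (4 t v + (4 - t²) y)` through `y` with velocity `v`. -/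
def stereoCurve (y v : EuclideanSpace ℝ (Fin (n + 1))) (t : ℝ) : EuclideanSpace ℝ (Fin (n + 1)) :=
  (t ^ 2 + 4)⁻¹ • ((4 * t) • v + (4 - t ^ 2) • y)

/-- The inverse of the stereographic chart centred at `y`, for an isometry `U` onto `y^⊥`. -/
def stereoParam (y : EuclideanSpace ℝ (Fin (n + 1)))
    (U : EuclideanSpace ℝ (Fin n) →ₗᵢ[ℝ] EuclideanSpace ℝ (Fin (n + 1)))
    (x : EuclideanSpace ℝ (Fin n)) : EuclideanSpace ℝ (Fin (n + 1)) :=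
  (‖x‖ ^ 2 + 4)⁻¹ • ((4 : ℝ) • U x + (4 - ‖x‖ ^ 2) • y)

theorem exists_chart_symm_eq (y : Sphere n) :
    ∃ U : EuclideanSpace ℝ (Fin n) →ₗᵢ[ℝ] EuclideanSpace ℝ (Fin (n + 1)),
      (∀ x, inner ℝ (U x) y.1 = 0) ∧
      (∀ k l, ∑ i, U (EuclideanSpace.single i 1) k * U (EuclideanSpace.single i 1) l =
        (if k = l then 1 else 0) - y.1 k * y.1 l) ∧
      chartAt (EuclideanSpace ℝ (Fin n)) y y = 0 ∧
      ∀ x, ((chartAt (EuclideanSpace ℝ (Fin n)) y).symm x : EuclideanSpace ℝ (Fin (n + 1))) =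
        stereoParam y.1 U x := by
  have : Fact (Module.finrank ℝ (EuclideanSpace ℝ (Fin (n + 1))) = n + 1) :=
    Fact.mk (@finrank_euclideanSpace_fin ℝ _ (n + 1))
  have hchart : chartAt (EuclideanSpace ℝ (Fin n)) y = stereographic' n (-y) := rfl
  let W : Submodule ℝ (EuclideanSpace ℝ (Fin (n + 1))) :=
    -- The chart at y projects from -y, so y goes to the origin and the model space is y^⊥.
    (ℝ ∙ ((-y : Sphere n) : EuclideanSpace ℝ (Fin (n + 1))))ᗮ
  let b : OrthonormalBasis (Fin n) ℝ W :=
    OrthonormalBasis.fromOrthogonalSpanSingleton (𝕜 := ℝ) n (ne_zero_of_mem_unit_sphere (-y))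
  have hy : ‖y.1‖ = 1 := norm_eq_of_mem_sphere y
  have horth : ∀ w : W, inner ℝ (w : EuclideanSpace ℝ (Fin (n + 1))) y.1 = 0 := by
    intro w
    have := Submodule.mem_orthogonal_singleton_iff_inner_left.1 w.2
    simpa using this
  refine ⟨W.subtypeₗᵢ.comp b.repr.symm.toLinearIsometry, fun x => horth _, fun k l => ?_, ?_,
    fun x => ?_⟩
  -- The sum is Parseval's identity in y^⊥ for the orthogonal projections e_k - y_k y and e_l - y_l
  -- y.
  · have hproj : ∀ k, ∃ p : W, (p : EuclideanSpace ℝ (Fin (n + 1))) =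
        EuclideanSpace.single k 1 - y.1 k • y.1 := by
      intro k
      refine ⟨⟨EuclideanSpace.single k 1 - y.1 k • y.1, ?_⟩, rfl⟩
      rw [Submodule.mem_orthogonal_singleton_iff_inner_left]
      simp [inner_sub_left, inner_smul_left, hy, EuclideanSpace.inner_single_left]
    have hcoord : ∀ i k, (b i : EuclideanSpace ℝ (Fin (n + 1))) k =
        inner ℝ (b i) (hproj k).choose := by
      intro i k
      rw [Submodule.coe_inner, (hproj k).choose_spec, inner_sub_right, inner_smul_right, horth]
      simp [EuclideanSpace.inner_single_right]
    have hsum := b.sum_inner_mul_inner (hproj k).choose (hproj l).choose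
    simp only [LinearIsometry.coe_comp, Function.comp_apply, Submodule.coe_subtypeₗᵢ,
      LinearIsometryEquiv.coe_toLinearIsometry, OrthonormalBasis.repr_symm_single,
      Submodule.coe_subtype]
    simp only [hcoord]
    calc _ = ∑ i, inner ℝ (hproj k).choose (b i) * inner ℝ (b i) (hproj l).choose :=
          Finset.sum_congr rfl fun i _ => by rw [real_inner_comm]
      _ = _ := hsum
      _ = _ := by
        rw [Submodule.coe_inner, (hproj k).choose_spec, (hproj l).choose_spec]
        simp only [inner_sub_left, inner_sub_right, inner_smul_left, inner_smul_right,
          real_inner_self_eq_norm_sq, hy]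
        simp [EuclideanSpace.inner_single_left, EuclideanSpace.inner_single_right, eq_comm]
  · have h1 : stereographic' n (-y) y = b.repr (stereographic (norm_eq_of_mem_sphere (-y)) y) := rfl
    rw [hchart, h1, stereographic_neg_apply, map_zero]
  · rw [hchart, stereographic'_symm_apply]
    change (‖((b.repr.symm x : W) : EuclideanSpace ℝ (Fin (n + 1)))‖ ^ 2 + 4)⁻¹ •
      (4 : ℝ) • ((b.repr.symm x : W) : EuclideanSpace ℝ (Fin (n + 1))) +
      (‖((b.repr.symm x : W) : EuclideanSpace ℝ (Fin (n + 1)))‖ ^ 2 + 4)⁻¹ •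
      (‖((b.repr.symm x : W) : EuclideanSpace ℝ (Fin (n + 1)))‖ ^ 2 - 4) • (-y.1) =
      (‖x‖ ^ 2 + 4)⁻¹ • ((4 : ℝ) • ((b.repr.symm x : W) : EuclideanSpace ℝ (Fin (n + 1))) +
        (4 - ‖x‖ ^ 2) • y.1)
    rw [← Submodule.coe_norm, LinearIsometryEquiv.norm_map]
    module

end Chart

end

/-! ### The round metric and the tension field in the stereographic chart. -/

section

open Filter Topology Set InnerProductSpace
open scoped ContDiff Manifold

section Metric

variable {n : ℕ} {y : EuclideanSpace ℝ (Fin (n + 1))}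
  {U : EuclideanSpace ℝ (Fin n) →ₗᵢ[ℝ] EuclideanSpace ℝ (Fin (n + 1))}

theorem contDiff_stereoParam {k : WithTop ℕ∞} : ContDiff ℝ k (stereoParam y U) := by
  have h0 : ContDiff ℝ k fun x : EuclideanSpace ℝ (Fin n) => ‖x‖ ^ 2 := contDiff_norm_sq ℝ
  have h1 : ContDiff ℝ k fun x : EuclideanSpace ℝ (Fin n) => (‖x‖ ^ 2 + 4)⁻¹ :=
    (h0.add contDiff_const).inv fun x => by positivity
  have h2 : ContDiff ℝ k fun x => (4 : ℝ) • U x + (4 - ‖x‖ ^ 2) • y :=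
    (U.toContinuousLinearMap.contDiff.const_smul (4 : ℝ)).add
      ((contDiff_const.sub h0).smul contDiff_const)
  exact h1.smul h2

theorem stereoParam_smul {w : EuclideanSpace ℝ (Fin n)} (hw : ‖w‖ = 1) (t : ℝ) :
    stereoParam y U (t • w) = stereoCurve y (U w) t := by
  simp [stereoParam, stereoCurve, norm_smul, hw, smul_smul]

theorem fderiv_stereoParam_apply (x w : EuclideanSpace ℝ (Fin n)) :
    fderiv ℝ (stereoParam y U) x w = (4 * (‖x‖ ^ 2 + 4)⁻¹) • U w -
      (8 * inner ℝ x w * ((‖x‖ ^ 2 + 4)⁻¹) ^ 2) • U x -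
      (16 * inner ℝ x w * ((‖x‖ ^ 2 + 4)⁻¹) ^ 2) • y := by
  have hN : ‖x‖ ^ 2 + 4 ≠ 0 := by positivity
  have h0 : HasFDerivAt (fun x : EuclideanSpace ℝ (Fin n) => ‖x‖ ^ 2) (2 • innerSL ℝ x) x :=
    (hasStrictFDerivAt_norm_sq x).hasFDerivAt
  have h1 : HasFDerivAt (fun x : EuclideanSpace ℝ (Fin n) => (‖x‖ ^ 2 + 4)⁻¹) _ x :=
    (hasDerivAt_inv hN).comp_hasFDerivAt x (h0.add_const 4)
  have h2 : HasFDerivAt (fun x : EuclideanSpace ℝ (Fin n) => (4 : ℝ) • U x + (4 - ‖x‖ ^ 2) • y) _ x :=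
    (U.toContinuousLinearMap.hasFDerivAt.const_smul (4 : ℝ)).add
      ((h0.const_sub 4).smul_const y)
  rw [(show HasFDerivAt (stereoParam y U) _ x from h1.smul h2).fderiv]
  simp only [add_apply, smul_apply, ContinuousLinearMap.smulRight_apply, neg_apply,
    innerSL_apply_apply, LinearIsometry.coe_toContinuousLinearMap, smul_eq_mul, nsmul_eq_mul]
  match_scalars <;> field_simp <;> ring

theorem inner_fderiv_stereoParam (hy : ‖y‖ = 1) (hU : ∀ x, inner ℝ (U x) y = 0)
    (x v w : EuclideanSpace ℝ (Fin n)) :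
    inner ℝ (fderiv ℝ (stereoParam y U) x v) (fderiv ℝ (stereoParam y U) x w) =
      (4 * (‖x‖ ^ 2 + 4)⁻¹) ^ 2 * inner ℝ v w := by
  have hN : ‖x‖ ^ 2 + 4 ≠ 0 := by positivity
  have hU' : ∀ x, inner ℝ y (U x) = 0 := fun x => by rw [real_inner_comm, hU]
  rw [fderiv_stereoParam_apply, fderiv_stereoParam_apply]
  simp only [inner_sub_left, inner_sub_right, real_inner_smul_left, real_inner_smul_right, hU, hU',
    LinearIsometry.inner_map_map, real_inner_self_eq_norm_sq, hy, real_inner_comm x v]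
  field_simp
  ring

/-- The metric coefficient `g^{ii} √|g|` in stereographic coordinates, as a function of `|x|²`. -/
def stereoCoeff (n : ℕ) (s : ℝ) : ℝ := ((4 * (s + 4)⁻¹) ^ 2)⁻¹ * (4 * (s + 4)⁻¹) ^ n

/-- A function of |x|² has no linear term at 0. This removes the first-order part of the
Laplace-Beltrami operator at the centre of the chart. -/
theorem hasFDerivAt_stereoCoeff_zero :
    HasFDerivAt (fun x : EuclideanSpace ℝ (Fin n) => stereoCoeff n (‖x‖ ^ 2))
      (0 : EuclideanSpace ℝ (Fin n) →L[ℝ] ℝ) 0 := by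
  have h0 : HasFDerivAt (fun x : EuclideanSpace ℝ (Fin n) => ‖x‖ ^ 2)
      (2 • innerSL ℝ (0 : EuclideanSpace ℝ (Fin n))) 0 :=
    (hasStrictFDerivAt_norm_sq _).hasFDerivAt
  have h1 : DifferentiableAt ℝ (stereoCoeff n) (‖(0 : EuclideanSpace ℝ (Fin n))‖ ^ 2) := by
    unfold stereoCoeff
    refine DifferentiableAt.mul ?_ ?_
    · refine DifferentiableAt.inv ?_ (by simp)
      refine (((differentiableAt_id.add_const _).inv (by simp)).const_mul _).pow _
    · refine (((differentiableAt_id.add_const _).inv (by simp)).const_mul _).pow _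
  have h2 := h1.hasDerivAt.comp_hasFDerivAt (f := fun x : EuclideanSpace ℝ (Fin n) => ‖x‖ ^ 2) 0 h0
  simpa [Function.comp_def] using h2

end Metric

section Tension

variable {n : ℕ}

/-- The Laplace-Beltrami operator in the stereographic chart centred at the point. -/
theorem coordLaplaceBeltrami_conformal {g : EuclideanSpace ℝ (Fin n) → Matrix (Fin n) (Fin n) ℝ}
    (hg : ∀ x, g x = (4 * (‖x‖ ^ 2 + 4)⁻¹) ^ 2 • (1 : Matrix (Fin n) (Fin n) ℝ))
    {u : EuclideanSpace ℝ (Fin n) → ℂ} (hu : ContDiffAt ℝ 2 u 0) :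
    coordLaplaceBeltrami g u 0 = ∑ i, partialDeriv i (partialDeriv i u) 0 := by
  have hdet : ∀ x, √|(g x).det| = (4 * (‖x‖ ^ 2 + 4)⁻¹) ^ n := by
    intro x
    rw [hg, Matrix.det_smul, Matrix.det_one, mul_one, Fintype.card_fin, ← pow_mul, mul_comm 2 n,
      pow_mul, abs_of_nonneg (by positivity), Real.sqrt_sq (by positivity)]
  have hcoeff : ∀ x i j, (g x)⁻¹ i j * √|(g x).det| =
      if i = j then stereoCoeff n (‖x‖ ^ 2) else 0 := by
    intro x i j
    have hN : (4 * (‖x‖ ^ 2 + 4)⁻¹) ^ 2 ≠ 0 := by positivity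
    have hinv : (g x)⁻¹ = ((4 * (‖x‖ ^ 2 + 4)⁻¹) ^ 2)⁻¹ • (1 : Matrix (Fin n) (Fin n) ℝ) := by
      refine Matrix.inv_eq_right_inv ?_
      rw [hg, smul_mul_smul_comm, mul_inv_cancel₀ hN, one_smul, one_mul]
    rw [hdet, hinv, Matrix.smul_apply, Matrix.one_apply]
    split_ifs <;> simp [stereoCoeff]
  unfold coordLaplaceBeltrami
  refine Finset.sum_congr rfl fun i _ => ?_
  simp only [hcoeff]
  simp only [hdet]
  rw [Finset.sum_eq_single i]
  · have hd : DifferentiableAt ℝ (partialDeriv i u) 0 := by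
      have := (hu.fderiv_right (m := 1) (by norm_num)).differentiableAt (by norm_num)
      exact this.clm_apply (differentiableAt_const _)
    -- In the product rule only the second derivative of u survives, with coefficient 1, as the
    -- conformal factor 4/(|x|²+4) is 1 at the origin.
    have h1 := hasFDerivAt_stereoCoeff_zero.smul hd.hasFDerivAt
    simp only [if_true]
    rw [partialDeriv, (show HasFDerivAt (fun z => stereoCoeff n (‖z‖ ^ 2) • partialDeriv i u z) _ 0
      from h1).fderiv]
    simp [stereoCoeff, partialDeriv]
  · intro j _ hj
    simp [partialDeriv, hj.symm]
  · simp

theorem partialDeriv_partialDeriv_zero {u : EuclideanSpace ℝ (Fin n) → ℂ}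
    (hu : ContDiffAt ℝ 2 u 0) (i : Fin n) :
    partialDeriv i (partialDeriv i u) 0 =
      deriv (deriv fun t : ℝ => u (t • EuclideanSpace.single i 1)) 0 := by
  set e : EuclideanSpace ℝ (Fin n) := EuclideanSpace.single i 1
  have hl : ∀ t : ℝ, HasDerivAt (fun t : ℝ => t • e) e t := fun t => by
    simpa using (hasDerivAt_id t).smul_const e
  have hc : ContinuousAt (fun t : ℝ => t • e) 0 := (hl 0).continuousAt
  have hev : ∀ᶠ t : ℝ in 𝓝 0, ContDiffAt ℝ 2 u (t • e) :=
    hc.eventually (by simpa using hu.eventually (by simp))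
  have h1 : (deriv fun t : ℝ => u (t • e)) =ᶠ[𝓝 0] fun t => partialDeriv i u (t • e) := by
    filter_upwards [hev] with t ht
    exact ((ht.differentiableAt (by norm_num)).hasFDerivAt.comp_hasDerivAt t (hl t)).deriv
  rw [h1.deriv_eq]
  have hd : DifferentiableAt ℝ (partialDeriv i u) ((0 : ℝ) • e) := by
    rw [zero_smul]
    have := (hu.fderiv_right (m := 1) (by norm_num)).differentiableAt (by norm_num)
    exact this.clm_apply (differentiableAt_const _)
  have h2 := (hd.hasFDerivAt.comp_hasDerivAt (0 : ℝ) (hl 0)).deriv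
  rw [zero_smul] at h2
  exact h2.symm

/-- The tension field at `y` is the sum of second derivatives along curves on the sphere. -/
theorem exists_tension_eq_sum (y : Sphere n) :
    ∃ v : Fin n → EuclideanSpace ℝ (Fin (n + 1)),
      (∀ k l, ∑ i, v i k * v i l = (if k = l then 1 else 0) - y.1 k * y.1 l) ∧
      (∀ i t, ‖stereoCurve y.1 (v i) t‖ = 1) ∧
      ∀ (f : Sphere n → ℂ) (F : EuclideanSpace ℝ (Fin (n + 1)) → ℂ), ContDiffAt ℝ 2 F y.1 →
        (∀ᶠ z in 𝓝 y, f z = F z.1) →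
        tension f y = ∑ i, deriv (deriv fun t => F (stereoCurve y.1 (v i) t)) 0 := by
  obtain ⟨U, hU, hsum, hy0, hsymm⟩ := exists_chart_symm_eq y
  have hy : ‖y.1‖ = 1 := norm_eq_of_mem_sphere y
  refine ⟨fun i => U (EuclideanSpace.single i 1), hsum, fun i t => ?_, fun f F hF hf => ?_⟩
  · rw [← stereoParam_smul (by simp), ← hsymm]
    exact norm_eq_of_mem_sphere _
  have hφ : (fun x => ((chartAt (EuclideanSpace ℝ (Fin n)) y).symm x :
      EuclideanSpace ℝ (Fin (n + 1)))) = stereoParam y.1 U := funext hsymm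
  have hφ0 : stereoParam y.1 U 0 = y.1 := by
    simp [stereoParam]
  have hu : ContDiffAt ℝ 2 (fun x => F (stereoParam y.1 U x)) 0 := by
    refine ContDiffAt.comp (0 : EuclideanSpace ℝ (Fin n)) ?_ contDiff_stereoParam.contDiffAt
    rwa [hφ0]
  have hlim : Tendsto (chartAt (EuclideanSpace ℝ (Fin n)) y).symm (𝓝 0) (𝓝 y) := by
    have h1 := (chartAt (EuclideanSpace ℝ (Fin n)) y).tendsto_symm (mem_chart_source _ y)
    rwa [hy0] at h1
  have heq : (fun x => f ((chartAt (EuclideanSpace ℝ (Fin n)) y).symm x)) =ᶠ[𝓝 0]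
      fun x => F (stereoParam y.1 U x) := by
    filter_upwards [hlim.eventually hf] with x hx
    rw [hx, hsymm]
  have hg : ∀ x, roundMetric (chartAt (EuclideanSpace ℝ (Fin n)) y) x =
      (4 * (‖x‖ ^ 2 + 4)⁻¹) ^ 2 • (1 : Matrix (Fin n) (Fin n) ℝ) := by
    intro x
    ext i j
    rw [roundMetric, hφ]
    simp only [Matrix.of_apply, partialDeriv, inner_fderiv_stereoParam hy hU, Matrix.smul_apply,
      Matrix.one_apply, EuclideanSpace.inner_single_left]
    simp
  rw [tension, hy0, coordLaplaceBeltrami_conformal hg (hu.congr_of_eventuallyEq heq)]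
  refine Finset.sum_congr rfl fun i _ => ?_
  rw [partialDeriv_partialDeriv_zero (hu.congr_of_eventuallyEq heq)]
  have hl : ContinuousAt (fun t : ℝ => t • (EuclideanSpace.single i 1 : EuclideanSpace ℝ (Fin n)))
    0 := by fun_prop
  have h2 : (fun t : ℝ => f ((chartAt (EuclideanSpace ℝ (Fin n)) y).symm
      (t • EuclideanSpace.single i 1))) =ᶠ[𝓝 0]
      fun t => F (stereoCurve y.1 (U (EuclideanSpace.single i 1)) t) := by
    have h3 : Tendsto (fun t : ℝ => t • (EuclideanSpace.single i 1 : EuclideanSpace ℝ (Fin n)))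
      (𝓝 0) (𝓝 0) := by simpa [ContinuousAt] using hl
    filter_upwards [h3.eventually heq] with t ht
    rw [ht, stereoParam_smul (by simp)]
  exact h2.deriv.deriv_eq

end Tension

end

/-! ### Second derivatives along curves, and traces of complex Hessians. -/

section

open Filter Topology Set InnerProductSpace
open scoped ContDiff Manifold

section Calculus

/-- The second derivative at `0` of a quotient of quadratic polynomials. -/
theorem hasDerivAt_quadratic_div {a₀ a₁ a₂ d₀ d₁ d₂ : ℂ} (hd : d₀ ≠ 0) :
    ∃ q₁ : ℝ → ℂ, (∀ᶠ t : ℝ in 𝓝 0, HasDerivAt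
        (fun t : ℝ => (a₀ + a₁ * t + a₂ * t ^ 2) / (d₀ + d₁ * t + d₂ * t ^ 2)) (q₁ t) t) ∧
      q₁ 0 = (a₁ * d₀ - a₀ * d₁) / d₀ ^ 2 ∧
      HasDerivAt q₁ (2 * (a₂ * d₀ - a₀ * d₂) / d₀ ^ 2 - 2 * d₁ * (a₁ * d₀ - a₀ * d₁) / d₀ ^ 3) 0 := by
  have hq : ∀ (b₀ b₁ b₂ : ℂ) (t : ℝ), HasDerivAt (fun t : ℝ => b₀ + b₁ * t + b₂ * t ^ 2)
      (b₁ + 2 * b₂ * t) t := by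
    intro b₀ b₁ b₂ t
    have h1 : HasDerivAt (fun t : ℝ => (t : ℂ)) 1 t := Complex.ofRealCLM.hasDerivAt
    refine (((h1.const_mul b₁).const_add b₀).add ((h1.pow 2).const_mul b₂)).congr_deriv ?_
    push_cast
    ring
  have hl : ∀ (b₁ b₂ : ℂ) (t : ℝ), HasDerivAt (fun t : ℝ => b₁ + 2 * b₂ * t) (2 * b₂) t := by
    intro b₁ b₂ t
    have h1 : HasDerivAt (fun t : ℝ => (t : ℂ)) 1 t := Complex.ofRealCLM.hasDerivAt
    exact ((h1.const_mul (2 * b₂)).const_add b₁).congr_deriv (mul_one _)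
  have hD0 : d₀ + d₁ * ((0 : ℝ) : ℂ) + d₂ * ((0 : ℝ) : ℂ) ^ 2 ≠ 0 := by simpa using hd
  refine ⟨fun t => ((a₁ + 2 * a₂ * t) * (d₀ + d₁ * t + d₂ * t ^ 2) -
    (a₀ + a₁ * t + a₂ * t ^ 2) * (d₁ + 2 * d₂ * t)) / (d₀ + d₁ * t + d₂ * t ^ 2) ^ 2, ?_, ?_, ?_⟩
  · filter_upwards [(hq d₀ d₁ d₂ 0).continuousAt.eventually_ne hD0] with t ht
    exact (hq a₀ a₁ a₂ t).div (hq d₀ d₁ d₂ t) ht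
  · simp
  · have h1 := ((((hl a₁ a₂ 0).mul (hq d₀ d₁ d₂ 0)).sub ((hq a₀ a₁ a₂ 0).mul (hl d₁ d₂ 0))).div
      ((hq d₀ d₁ d₂ 0).pow 2) (pow_ne_zero 2 hD0))
    refine h1.congr_deriv ?_
    simp
    field_simp
    ring

variable {m : ℕ} {P : ℂ → ℂ} {H : (Fin m → ℂ) → ℂ}

/-- The second derivative of `P(s(t)) H(X(t))`. -/
theorem deriv_deriv_mul_comp {s s₁ : ℝ → ℂ} {X X₁ : ℝ → Fin m → ℂ} {s₂ : ℂ} {X₂ : Fin m → ℂ}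
    (hP : AnalyticAt ℂ P (s 0)) (hH : AnalyticAt ℂ H (X 0))
    (hs : ∀ᶠ t in 𝓝 0, HasDerivAt s (s₁ t) t) (hX : ∀ᶠ t in 𝓝 0, HasDerivAt X (X₁ t) t)
    (hs₁ : HasDerivAt s₁ s₂ 0) (hX₁ : HasDerivAt X₁ X₂ 0) :
    deriv (deriv fun t => P (s t) * H (X t)) 0 =
      (deriv (deriv P) (s 0) * s₁ 0 ^ 2 + deriv P (s 0) * s₂) * H (X 0) +
      2 * deriv P (s 0) * (s₁ 0 * fderiv ℂ H (X 0) (X₁ 0)) +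
      P (s 0) * (fderiv ℂ (fderiv ℂ H) (X 0) (X₁ 0) (X₁ 0) + fderiv ℂ H (X 0) X₂) := by
  have hsc : ContinuousAt s 0 := hs.self_of_nhds.continuousAt
  have hXc : ContinuousAt X 0 := hX.self_of_nhds.continuousAt
  have hcP : ∀ {Q : ℂ → ℂ} {t : ℝ}, AnalyticAt ℂ Q (s t) → HasDerivAt s (s₁ t) t →
      HasDerivAt (fun t => Q (s t)) (deriv Q (s t) * s₁ t) t := fun hQ hst =>
    hQ.differentiableAt.hasDerivAt.comp _ hst
  have hcH : ∀ {t : ℝ}, AnalyticAt ℂ H (X t) → HasDerivAt X (X₁ t) t →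
      HasDerivAt (fun t => H (X t)) (fderiv ℂ H (X t) (X₁ t)) t := fun hQ hXt =>
    (hQ.differentiableAt.hasFDerivAt.restrictScalars ℝ).comp_hasDerivAt _ hXt
  have hev : (deriv fun t => P (s t) * H (X t)) =ᶠ[𝓝 0] fun t =>
      deriv P (s t) * s₁ t * H (X t) + P (s t) * fderiv ℂ H (X t) (X₁ t) := by
    filter_upwards [hs, hX, hsc.eventually hP.eventually_analyticAt,
      hXc.eventually hH.eventually_analyticAt] with t h1 h2 h3 h4
    exact ((hcP h3 h1).mul (hcH h4 h2)).deriv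
  rw [hev.deriv_eq]
  have h1 := hcP hP hs.self_of_nhds
  have h2 := hcP hP.deriv hs.self_of_nhds
  have h3 := hcH hH hX.self_of_nhds
  have h4 := ((hH.fderiv.differentiableAt.hasFDerivAt.restrictScalars ℝ).comp_hasDerivAt (0 : ℝ)
    hX.self_of_nhds)
  have h5 : HasDerivAt (fun t => fderiv ℂ H (X t) (X₁ t))
      (fderiv ℂ (fderiv ℂ H) (X 0) (X₁ 0) (X₁ 0) + fderiv ℂ H (X 0) X₂) 0 := by
    have h6 := ((isBoundedBilinearMap_apply (𝕜 := ℂ) (E := Fin m → ℂ) (F := ℂ)).hasFDerivAt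
      (fderiv ℂ H (X 0), X₁ 0)).restrictScalars ℝ
    refine (h6.comp_hasDerivAt (0 : ℝ) (h4.prodMk hX₁)).congr_deriv ?_
    simp [add_comm]
  refine (((h2.mul hs₁).mul h3).add (h1.mul h5)).deriv.trans ?_
  simp only [Pi.mul_apply]
  ring

theorem complexLaplacian_eq_sum {z : Fin m → ℂ} (hH : AnalyticAt ℂ H z) :
    complexLaplacian H z =
      ∑ k, fderiv ℂ (fderiv ℂ H) z (Pi.single k 1) (Pi.single k 1) := by
  refine Finset.sum_congr rfl fun k _ => ?_
  rw [fderiv_clm_apply hH.fderiv.differentiableAt (differentiableAt_const _)]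
  simp

/-- The frame identity traces the complex Hessian to c times the complex Laplacian. -/
theorem sum_fderiv_fderiv_eq {ι : Type*} [Fintype ι] {z : Fin m → ℂ} (hH : AnalyticAt ℂ H z)
    {w : ι → Fin m → ℂ} {c : ℂ} (hw : ∀ k l, ∑ i, w i k * w i l = if k = l then c else 0) :
    ∑ i, fderiv ℂ (fderiv ℂ H) z (w i) (w i) = c * complexLaplacian H z := by
  have h1 : ∀ u : Fin m → ℂ, fderiv ℂ (fderiv ℂ H) z u u =
      ∑ k, ∑ l, u k * u l * fderiv ℂ (fderiv ℂ H) z (Pi.single k 1) (Pi.single l 1) := by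
    intro u
    have h2 : u = ∑ k, u k • (Pi.single k 1 : Fin m → ℂ) := by
      ext j
      simp [Finset.sum_apply, Pi.single_apply]
    conv_lhs => rw [h2]
    simp only [map_sum, map_smul, sum_apply, smul_apply, smul_eq_mul, Finset.mul_sum]
    rw [Finset.sum_comm]
    exact Finset.sum_congr rfl fun k _ => Finset.sum_congr rfl fun l _ => by ring
  simp only [h1]
  rw [Finset.sum_comm, complexLaplacian_eq_sum hH, Finset.mul_sum]
  refine Finset.sum_congr rfl fun k _ => ?_
  rw [Finset.sum_comm]
  simp only [← Finset.sum_mul, hw]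
  simp

end Calculus

end

/-! ### The functions T and X along the stereographic curves, and sums over a tangent frame. -/

section

open Filter Topology Set InnerProductSpace
open scoped ContDiff Manifold

section Ambient

variable {n : ℕ}

theorem contDiff_denom {k : WithTop ℕ∞} : ContDiff ℝ k (denom (n := n)) := by
  have h1 : ∀ i, ContDiff ℝ k fun y : EuclideanSpace ℝ (Fin (n + 1)) => (y i : ℂ) := fun i =>
    Complex.ofRealCLM.contDiff.comp (EuclideanSpace.proj (𝕜 := ℝ) i).contDiff
  exact (h1 1).add (contDiff_const.mul (h1 0))

theorem contDiffAt_argT {k : WithTop ℕ∞} {y : EuclideanSpace ℝ (Fin (n + 1))} (hd : denom y ≠ 0) :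
    ContDiffAt ℝ k (argT (n := n)) y := by
  have hy : y ≠ 0 := by
    rintro rfl
    simp [denom] at hd
  have h1 : ContDiffAt ℝ k (fun z : EuclideanSpace ℝ (Fin (n + 1)) => 2 * (‖z‖ : ℂ)) y :=
    contDiffAt_const.mul (Complex.ofRealCLM.contDiff.contDiffAt.comp y (contDiffAt_norm ℝ hy))
  exact h1.mul (contDiff_denom.contDiffAt.inv hd)

theorem contDiffAt_argX {k : WithTop ℕ∞} {y : EuclideanSpace ℝ (Fin (n + 1))} (hd : denom y ≠ 0) :
    ContDiffAt ℝ k (argX (n := n)) y := by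
  rw [contDiffAt_pi]
  intro j
  have h1 : ContDiff ℝ k fun z : EuclideanSpace ℝ (Fin (n + 1)) =>
      2 * (z ⟨j.1 + 2, by have := j.2; omega⟩ : ℂ) :=
    contDiff_const.mul (Complex.ofRealCLM.contDiff.comp (EuclideanSpace.proj (𝕜 := ℝ)
      (⟨j.1 + 2, by have := j.2; omega⟩ : Fin (n + 1))).contDiff)
  exact h1.contDiffAt.mul (contDiff_denom.contDiffAt.inv hd)

variable {P : ℂ → ℂ} {H : (Fin (n - 1) → ℂ) → ℂ}

/-- The formula for `sphereFun` on the ambient space. -/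
def ambientFun (P : ℂ → ℂ) (H : (Fin (n - 1) → ℂ) → ℂ) (z : EuclideanSpace ℝ (Fin (n + 1))) : ℂ :=
  P (argT z) * H (argX z)

theorem contDiffAt_ambientFun {k : WithTop ℕ∞} {y : EuclideanSpace ℝ (Fin (n + 1))}
    (hd : denom y ≠ 0) (hP : AnalyticAt ℂ P (argT y)) (hH : AnalyticAt ℂ H (argX y)) :
    ContDiffAt ℝ k (ambientFun P H) y :=
  ((hP.contDiffAt.restrict_scalars ℝ).comp y (contDiffAt_argT hd)).mul
    ((hH.contDiffAt.restrict_scalars ℝ).comp y (contDiffAt_argX hd))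

theorem contMDiffOn_sphereFun {W : Set (Sphere n)} {V : Set ℂ} {U : Set (Fin (n - 1) → ℂ)}
    (hP : AnalyticOnNhd ℂ P V) (hH : AnalyticOnNhd ℂ H U) (hW : MapsInto W V U) :
    ContMDiffOn (𝓡 n) 𝓘(ℝ, ℂ) ∞ (sphereFun P H) W := by
  intro y hy
  have : Fact (Module.finrank ℝ (EuclideanSpace ℝ (Fin (n + 1))) = n + 1) :=
    Fact.mk (@finrank_euclideanSpace_fin ℝ _ (n + 1))
  obtain ⟨hd, hV, hU⟩ := hW y hy
  have h1 : ContMDiffAt 𝓘(ℝ, EuclideanSpace ℝ (Fin (n + 1))) 𝓘(ℝ, ℂ) ∞ (ambientFun P H) y.1 :=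
    (contDiffAt_ambientFun hd (hP _ hV) (hH _ hU)).contMDiffAt
  have h2 : ContMDiffAt (𝓡 n) 𝓘(ℝ, EuclideanSpace ℝ (Fin (n + 1))) ∞
      (fun z : Sphere n => (z : EuclideanSpace ℝ (Fin (n + 1)))) y :=
    contMDiff_coe_sphere.contMDiffAt
  exact (h1.comp y h2).contMDiffWithinAt

end Ambient

section Frame

variable {n : ℕ}

theorem continuous_stereoCurve (y v : EuclideanSpace ℝ (Fin (n + 1))) :
    Continuous (stereoCurve y v) := by
  have h1 : ∀ t : ℝ, t ^ 2 + 4 ≠ 0 := fun t => by positivity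
  unfold stereoCurve
  exact ((by fun_prop : Continuous fun t : ℝ => t ^ 2 + 4).inv₀ h1).smul (by fun_prop)

theorem stereoCurve_zero (y v : EuclideanSpace ℝ (Fin (n + 1))) : stereoCurve y v 0 = y := by
  simp [stereoCurve]

theorem denom_stereoCurve (y v : EuclideanSpace ℝ (Fin (n + 1))) (t : ℝ) :
    denom (stereoCurve y v t) = ((t : ℂ) ^ 2 + 4)⁻¹ *
      (4 * denom y + 4 * denom v * t + -denom y * t ^ 2) := by
  simp only [denom, stereoCurve, PiLp.smul_apply, PiLp.add_apply, smul_eq_mul]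
  push_cast
  ring

theorem ofReal_sq_add_four_ne_zero (t : ℝ) : (t : ℂ) ^ 2 + 4 ≠ 0 := by
  have h : (t ^ 2 + 4 : ℝ) ≠ 0 := by positivity
  exact_mod_cast h

/-- The factor t² + 4 moves into the numerator as 2(t² + 4). The null coefficient is kept to match
the shape of `hasDerivAt_quadratic_div`. -/
theorem argT_stereoCurve {y v : EuclideanSpace ℝ (Fin (n + 1))} {t : ℝ}
    (ht : ‖stereoCurve y v t‖ = 1) :
    argT (stereoCurve y v t) =
      (8 + 0 * (t : ℂ) + 2 * t ^ 2) / (4 * denom y + 4 * denom v * t + -denom y * t ^ 2) := by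
  have h1 := ofReal_sq_add_four_ne_zero t
  rw [argT, ht, denom_stereoCurve]
  rw [div_mul_eq_div_div, div_inv_eq_mul]
  push_cast
  ring

theorem argX_stereoCurve (y v : EuclideanSpace ℝ (Fin (n + 1))) (t : ℝ) (k : Fin (n - 1)) :
    argX (stereoCurve y v t) k =
      (8 * (y ⟨k.1 + 2, by have := k.2; omega⟩ : ℂ) + 8 * (v ⟨k.1 + 2, by have := k.2; omega⟩ : ℂ) * t
        + -2 * (y ⟨k.1 + 2, by have := k.2; omega⟩ : ℂ) * t ^ 2) /
      (4 * denom y + 4 * denom v * t + -denom y * t ^ 2) := by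
  have h1 := ofReal_sq_add_four_ne_zero t
  rw [argX, denom_stereoCurve, div_mul_eq_div_div, div_inv_eq_mul]
  congr 1
  simp only [stereoCurve, PiLp.smul_apply, PiLp.add_apply, smul_eq_mul]
  push_cast
  field_simp
  ring

/-- The velocity of `argT` along `stereoCurve y v`. -/
def velT (y v : EuclideanSpace ℝ (Fin (n + 1))) : ℂ := -2 * denom v / denom y ^ 2

/-- The velocity of `argX` along `stereoCurve y v`. -/
def velX (y v : EuclideanSpace ℝ (Fin (n + 1))) (k : Fin (n - 1)) : ℂ :=
  2 * ((v ⟨k.1 + 2, by have := k.2; omega⟩ : ℂ) * denom y -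
    (y ⟨k.1 + 2, by have := k.2; omega⟩ : ℂ) * denom v) / denom y ^ 2

theorem exists_hasDerivAt_argT {y v : EuclideanSpace ℝ (Fin (n + 1))} (hd : denom y ≠ 0)
    (hv : ∀ t, ‖stereoCurve y v t‖ = 1) :
    ∃ s₁ : ℝ → ℂ, (∀ᶠ t in 𝓝 0, HasDerivAt (fun t => argT (stereoCurve y v t)) (s₁ t) t) ∧
      s₁ 0 = velT y v ∧
      HasDerivAt s₁ (2 / denom y + 4 * denom v ^ 2 / denom y ^ 3) 0 := by
  obtain ⟨q₁, h1, h2, h3⟩ := hasDerivAt_quadratic_div (a₀ := 8) (a₁ := 0) (a₂ := 2)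
    (d₁ := 4 * denom v) (d₂ := -denom y) (d₀ := 4 * denom y) (mul_ne_zero (by norm_num) hd)
  refine ⟨q₁, ?_, ?_, h3.congr_deriv ?_⟩
  · simpa only [argT_stereoCurve (hv _)] using h1
  · rw [h2, velT]
    field_simp
    ring
  · field_simp
    ring

theorem exists_hasDerivAt_argX {y : EuclideanSpace ℝ (Fin (n + 1))} (hd : denom y ≠ 0)
    (v : EuclideanSpace ℝ (Fin (n + 1))) :
    ∃ X₁ : ℝ → Fin (n - 1) → ℂ,
      (∀ᶠ t in 𝓝 0, HasDerivAt (fun t => argX (stereoCurve y v t)) (X₁ t) t) ∧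
      X₁ 0 = velX y v ∧ HasDerivAt X₁ ((-2 * denom v / denom y) • velX y v) 0 := by
  have h := fun k : Fin (n - 1) => hasDerivAt_quadratic_div
    (a₀ := 8 * (y ⟨k.1 + 2, by have := k.2; omega⟩ : ℂ))
    (a₁ := 8 * (v ⟨k.1 + 2, by have := k.2; omega⟩ : ℂ))
    (a₂ := -2 * (y ⟨k.1 + 2, by have := k.2; omega⟩ : ℂ))
    (d₁ := 4 * denom v) (d₂ := -denom y) (d₀ := 4 * denom y) (mul_ne_zero (by norm_num) hd)
  choose q₁ h1 h2 h3 using h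
  refine ⟨fun t k => q₁ k t, ?_, ?_, ?_⟩
  · filter_upwards [eventually_all.2 h1] with t ht
    rw [hasDerivAt_pi]
    intro k
    simpa only [argX_stereoCurve] using ht k
  · ext k
    simp only [h2, velX]
    field_simp
    ring
  · rw [hasDerivAt_pi]
    intro k
    refine (h3 k).congr_deriv ?_
    simp only [Pi.smul_apply, velX, smul_eq_mul]
    field_simp
    ring

variable {y : EuclideanSpace ℝ (Fin (n + 1))} {v : Fin n → EuclideanSpace ℝ (Fin (n + 1))}

theorem sum_ofReal_mul
    (hv : ∀ k l, ∑ i, v i k * v i l = (if k = l then 1 else 0) - y k * y l) (k l : Fin (n + 1)) :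
    ∑ i, (v i k : ℂ) * v i l = (if k = l then 1 else 0) - y k * y l := by
  have := congrArg (fun x : ℝ => (x : ℂ)) (hv k l)
  rw [Complex.ofReal_sum] at this
  simpa [apply_ite (fun x : ℝ => (x : ℂ))] using this

/-- Of the projection matrix δ_kl - y_k y_l, the identity part contributes 1 + i² = 0: the
coefficient vector of `denom` is isotropic. -/
theorem sum_denom_mul_denom (hn : 2 ≤ n)
    (hv : ∀ k l, ∑ i, v i k * v i l = (if k = l then 1 else 0) - y k * y l) :
    ∑ i, denom (v i) ^ 2 = -denom y ^ 2 := by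
  have h10 : (1 : Fin (n + 1)) ≠ 0 := by
    simp [Fin.ext_iff]; omega
  have h1 : ∀ i, denom (v i) ^ 2 = (v i 1 : ℂ) * v i 1 + 2 * Complex.I * ((v i 1 : ℂ) * v i 0) -
      (v i 0 : ℂ) * v i 0 := by
    intro i
    rw [denom]
    linear_combination ((v i 0 : ℂ) ^ 2) * Complex.I_sq
  simp only [h1, Finset.sum_add_distrib, Finset.sum_sub_distrib, ← Finset.mul_sum,
    sum_ofReal_mul hv, h10, if_true, if_false]
  rw [denom]
  linear_combination ((y 0 : ℂ) ^ 2) * Complex.I_sq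

/-- The remaining coordinates are orthogonal to the two entering `denom`, so the identity part again
contributes nothing. -/
theorem sum_denom_mul (hv : ∀ k l, ∑ i, v i k * v i l = (if k = l then 1 else 0) - y k * y l)
    {k : Fin (n + 1)} (hk0 : 0 ≠ k) (hk1 : 1 ≠ k) :
    ∑ i, denom (v i) * (v i k : ℂ) = -denom y * y k := by
  have h1 : ∀ i, denom (v i) * (v i k : ℂ) = (v i 1 : ℂ) * v i k + Complex.I * ((v i 0 : ℂ) * v i k) := by
    intro i
    rw [denom]
    ring
  simp only [h1, Finset.sum_add_distrib, ← Finset.mul_sum, sum_ofReal_mul hv, hk0, hk1, if_false]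
  rw [denom]
  ring

theorem coord_ne {k : Fin (n - 1)} {hk : k.1 + 2 < n + 1} :
    (0 : Fin (n + 1)) ≠ ⟨k.1 + 2, hk⟩ ∧ (1 : Fin (n + 1)) ≠ ⟨k.1 + 2, hk⟩ := by
  have h : 1 < n + 1 := by omega
  constructor
  · simp [Fin.ext_iff]
  · simp [Fin.ext_iff, Nat.mod_eq_of_lt h]

/-- This is (∇T,∇X_k) = 0 up to a factor. It removes both the cross terms and the first-order terms
in H. -/
theorem sum_denom_mul_velX (hn : 2 ≤ n)
    (hv : ∀ k l, ∑ i, v i k * v i l = (if k = l then 1 else 0) - y k * y l) (k : Fin (n - 1)) :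
    ∑ i, denom (v i) * velX y (v i) k = 0 := by
  have h1 : ∀ i, denom (v i) * velX y (v i) k =
      2 / denom y ^ 2 * (denom y * (denom (v i) * (v i ⟨k.1 + 2, by have := k.2; omega⟩ : ℂ)) -
      y ⟨k.1 + 2, by have := k.2; omega⟩ * denom (v i) ^ 2) := by
    intro i
    rw [velX]
    ring
  simp only [h1, ← Finset.mul_sum, Finset.sum_sub_distrib, sum_denom_mul_denom hn hv,
    sum_denom_mul hv coord_ne.1 coord_ne.2]
  ring

theorem sum_velX_mul_velX (hn : 2 ≤ n) (hd : denom y ≠ 0)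
    (hv : ∀ k l, ∑ i, v i k * v i l = (if k = l then 1 else 0) - y k * y l) (k l : Fin (n - 1)) :
    ∑ i, velX y (v i) k * velX y (v i) l = if k = l then (2 / denom y) ^ 2 else 0 := by
  have hk : k.1 + 2 < n + 1 := by have := k.2; omega
  have hl : l.1 + 2 < n + 1 := by have := l.2; omega
  have h1 : ∀ i, velX y (v i) k * velX y (v i) l = 4 / denom y ^ 4 *
      (denom y ^ 2 * ((v i ⟨k.1 + 2, hk⟩ : ℂ) * v i ⟨l.1 + 2, hl⟩)
      - denom y * y ⟨k.1 + 2, hk⟩ * (denom (v i) * (v i ⟨l.1 + 2, hl⟩ : ℂ))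
      - denom y * y ⟨l.1 + 2, hl⟩ * (denom (v i) * (v i ⟨k.1 + 2, hk⟩ : ℂ))
      + y ⟨k.1 + 2, hk⟩ * y ⟨l.1 + 2, hl⟩ * denom (v i) ^ 2) := by
    intro i
    rw [velX, velX]
    ring
  simp only [h1, ← Finset.mul_sum, Finset.sum_sub_distrib, Finset.sum_add_distrib,
    sum_denom_mul_denom hn hv, sum_denom_mul hv coord_ne.1 coord_ne.2, sum_ofReal_mul hv]
  have h2 : (⟨k.1 + 2, hk⟩ : Fin (n + 1)) = ⟨l.1 + 2, hl⟩ ↔ k = l := by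
    simp [Fin.ext_iff]
  simp only [h2]
  split_ifs
  · field_simp
    ring
  · ring

end Frame

end

/-! ### The tension field of P(T)H(X). -/

section

open Filter Topology Set
open scoped ContDiff Manifold

section TensionFormula

variable {n : ℕ} {P : ℂ → ℂ} {H : (Fin (n - 1) → ℂ) → ℂ}

/-- The operator on the radial factor induced by the tension field. -/
def radialOp (n : ℕ) (P : ℂ → ℂ) (s : ℂ) : ℂ :=
  -s ^ 2 * deriv (deriv P) s + (n - 2) * s * deriv P s

theorem argT_sphere (y : Sphere n) : argT y.1 = 2 / denom y.1 := by
  rw [argT, norm_eq_of_mem_sphere y]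
  simp

theorem sum_smul_velX (hn : 2 ≤ n) {y : EuclideanSpace ℝ (Fin (n + 1))}
    {v : Fin n → EuclideanSpace ℝ (Fin (n + 1))}
    (hv : ∀ k l, ∑ i, v i k * v i l = (if k = l then 1 else 0) - y k * y l) :
    ∑ i, denom (v i) • velX y (v i) = 0 := by
  ext k
  simpa using sum_denom_mul_velX hn hv k

/-- Summing second derivatives over the frame, the mixed terms and the first derivatives of H
cancel, and the Hessian of H traces to T²ΔH = 0. The function f need only agree with the product
near y, which is all that is known about iterates of `tension`. -/
theorem tension_eq_of_eventuallyEq (hn : 2 ≤ n) {y : Sphere n} (hd : denom y.1 ≠ 0)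
    (hP : AnalyticAt ℂ P (argT y.1)) (hH : AnalyticAt ℂ H (argX y.1))
    (hL : complexLaplacian H (argX y.1) = 0) {f : Sphere n → ℂ}
    (hf : ∀ᶠ z in 𝓝 y, f z = sphereFun P H z) :
    tension f y = sphereFun (radialOp n P) H y := by
  obtain ⟨v, hv, hv1, htens⟩ := exists_tension_eq_sum y
  rw [htens f (ambientFun P H) (contDiffAt_ambientFun hd hP hH) hf]
  have hterm : ∀ i, deriv (deriv fun t => ambientFun P H (stereoCurve y.1 (v i) t)) 0 =
      (deriv (deriv P) (argT y.1) * velT y.1 (v i) ^ 2 +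
        deriv P (argT y.1) * (2 / denom y.1 + 4 * denom (v i) ^ 2 / denom y.1 ^ 3)) * H (argX y.1) +
      2 * deriv P (argT y.1) * (velT y.1 (v i) * fderiv ℂ H (argX y.1) (velX y.1 (v i))) +
      P (argT y.1) * (fderiv ℂ (fderiv ℂ H) (argX y.1) (velX y.1 (v i)) (velX y.1 (v i)) +
        fderiv ℂ H (argX y.1) ((-2 * denom (v i) / denom y.1) • velX y.1 (v i))) := by
    intro i
    obtain ⟨s₁, hs, hs0, hs₁⟩ := exists_hasDerivAt_argT hd (hv1 i)
    obtain ⟨X₁, hX, hX0, hX₁⟩ := exists_hasDerivAt_argX hd (v i)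
    have h := deriv_deriv_mul_comp (P := P) (H := H) (by rwa [stereoCurve_zero])
      (by rwa [stereoCurve_zero]) hs hX hs₁ hX₁
    rw [hs0, hX0, stereoCurve_zero] at h
    exact h
  have h1 : ∑ i, velT y.1 (v i) ^ 2 = -(2 / denom y.1) ^ 2 := by
    have : ∀ i, velT y.1 (v i) ^ 2 = 4 / denom y.1 ^ 4 * denom (v i) ^ 2 := fun i => by
      rw [velT]
      ring
    simp only [this, ← Finset.mul_sum, sum_denom_mul_denom hn hv]
    field_simp
    norm_num
  have h2 : ∑ i, (2 / denom y.1 + 4 * denom (v i) ^ 2 / denom y.1 ^ 3) =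
      ((n : ℂ) - 2) * (2 / denom y.1) := by
    have : ∀ i, 4 * denom (v i) ^ 2 / denom y.1 ^ 3 = 4 / denom y.1 ^ 3 * denom (v i) ^ 2 :=
      fun i => by ring
    simp only [this, Finset.sum_add_distrib, ← Finset.mul_sum, sum_denom_mul_denom hn hv]
    simp only [Finset.sum_const, Finset.card_univ, Fintype.card_fin, nsmul_eq_mul]
    field_simp
    ring
  have hlin : ∀ c : ℂ, ∑ i, fderiv ℂ H (argX y.1) ((c * denom (v i)) • velX y.1 (v i)) = 0 := by
    intro c
    simp only [mul_smul]
    rw [← map_sum, ← Finset.smul_sum, sum_smul_velX hn hv, smul_zero, map_zero]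
  have h3 : ∑ i, velT y.1 (v i) * fderiv ℂ H (argX y.1) (velX y.1 (v i)) = 0 := by
    rw [← hlin (-2 / denom y.1 ^ 2)]
    refine Finset.sum_congr rfl fun i _ => ?_
    rw [map_smul, smul_eq_mul, velT]
    ring
  have h4 : ∑ i, fderiv ℂ H (argX y.1) ((-2 * denom (v i) / denom y.1) • velX y.1 (v i)) = 0 := by
    rw [← hlin (-2 / denom y.1)]
    refine Finset.sum_congr rfl fun i _ => ?_
    rw [div_mul_eq_mul_div]
  have h5 : ∑ i, fderiv ℂ (fderiv ℂ H) (argX y.1) (velX y.1 (v i)) (velX y.1 (v i)) = 0 := by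
    rw [sum_fderiv_fderiv_eq hH (sum_velX_mul_velX hn hd hv), hL, mul_zero]
  simp only [hterm, Finset.sum_add_distrib, ← Finset.mul_sum, ← Finset.sum_mul, h3, h4, h5, h1]
  rw [← Finset.sum_add_distrib, h2, sphereFun, radialOp, argT_sphere]
  ring

theorem analyticOnNhd_radialOp {V : Set ℂ} (hP : AnalyticOnNhd ℂ P V) (n : ℕ) :
    AnalyticOnNhd ℂ (radialOp n P) V := by
  intro s hs
  have h1 : AnalyticAt ℂ (fun s : ℂ => s) s := analyticAt_id
  exact ((h1.pow 2).neg.mul (hP.deriv.deriv s hs)).add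
    ((analyticAt_const.mul h1).mul (hP.deriv s hs))

theorem analyticOnNhd_iterate_radialOp {V : Set ℂ} (hP : AnalyticOnNhd ℂ P V) (n k : ℕ) :
    AnalyticOnNhd ℂ ((radialOp n)^[k] P) V := by
  induction k with
  | zero => exact hP
  | succ k ih =>
    rw [Function.iterate_succ_apply']
    exact analyticOnNhd_radialOp ih n

theorem iterate_tension_eq (hn : 2 ≤ n) {W : Set (Sphere n)} (hW : IsOpen W) {V : Set ℂ}
    {U : Set (Fin (n - 1) → ℂ)} (hm : MapsInto W V U) (hP : AnalyticOnNhd ℂ P V)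
    (hH : AnalyticOnNhd ℂ H U) (hL : ∀ z ∈ U, complexLaplacian H z = 0) (k : ℕ) :
    ∀ y ∈ W, (tension^[k] (sphereFun P H)) y = sphereFun ((radialOp n)^[k] P) H y := by
  induction k with
  | zero => exact fun y _ => rfl
  | succ k ih =>
    intro y hy
    obtain ⟨hd, hV, hU⟩ := hm y hy
    rw [Function.iterate_succ_apply', Function.iterate_succ_apply']
    exact tension_eq_of_eventuallyEq hn hd (analyticOnNhd_iterate_radialOp hP n k _ hV)
      (hH _ hU) (hL _ hU) (mem_of_superset (hW.mem_nhds hy) ih)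

end TensionFormula

end

/-! ### The radial equation in the variable log s. -/

section

open Filter Topology Set
open scoped Polynomial

section Radial

/-- The function `q₁(log s) + s^m q₂(log s)`. -/
def logProfile (m : ℕ) (q₁ q₂ : ℂ[X]) (s : ℂ) : ℂ :=
  q₁.eval (Complex.log s) + s ^ m * q₂.eval (Complex.log s)

theorem hasDerivAt_logProfile {m : ℕ} (q₁ q₂ : ℂ[X]) {s : ℂ} (hs : s ∈ Complex.slitPlane) :
    HasDerivAt (logProfile m q₁ q₂)
      (s⁻¹ * logProfile m q₁.derivative (m * q₂ + q₂.derivative) s) s := by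
  have hs0 : s ≠ 0 := Complex.slitPlane_ne_zero hs
  have hlog := Complex.hasDerivAt_log hs
  have h1 : ∀ q : ℂ[X], HasDerivAt (fun s => q.eval (Complex.log s))
      (q.derivative.eval (Complex.log s) * s⁻¹) s := fun q => (q.hasDerivAt _).comp s hlog
  refine ((h1 q₁).add ((hasDerivAt_pow m s).mul (h1 q₂))).congr_deriv ?_
  have h2 : (m : ℂ) * s ^ (m - 1) = m * s ^ m * s⁻¹ := by
    rcases Nat.eq_zero_or_pos m with rfl | hm
    · simp
    · rw [← pow_sub_one_mul hm.ne' s]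
      field_simp
  rw [h2]
  simp only [logProfile, Polynomial.eval_add, Polynomial.eval_mul, Polynomial.eval_natCast]
  ring

theorem analyticOnNhd_logProfile (m : ℕ) (q₁ q₂ : ℂ[X]) :
    AnalyticOnNhd ℂ (logProfile m q₁ q₂) Complex.slitPlane :=
  DifferentiableOn.analyticOnNhd
    (fun _ hs => (hasDerivAt_logProfile q₁ q₂ hs).differentiableAt.differentiableWithinAt)
    Complex.isOpen_slitPlane

/-- The operator on the polynomial factors induced by `radialOp`. -/
def polyOp (c : ℂ) (q : ℂ[X]) : ℂ[X] :=
  Polynomial.C c * q.derivative - q.derivative.derivative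

/-- With u = log s, `radialOp` is -∂² + (n-1)∂. Conjugation by s^{n-1} replaces ∂ by ∂ + (n-1),
which only reverses the sign of the first-order coefficient. -/
theorem radialOp_logProfile {n : ℕ} (hn : 1 ≤ n) (q₁ q₂ : ℂ[X]) {s : ℂ}
    (hs : s ∈ Complex.slitPlane) :
    radialOp n (logProfile (n - 1) q₁ q₂) s =
      logProfile (n - 1) (polyOp (n - 1 : ℕ) q₁) (polyOp (-(n - 1 : ℕ)) q₂) s := by
  have hs0 : s ≠ 0 := Complex.slitPlane_ne_zero hs
  have h1 : deriv (logProfile (n - 1) q₁ q₂) =ᶠ[𝓝 s] fun s => s⁻¹ *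
      logProfile (n - 1) q₁.derivative ((n - 1 : ℕ) * q₂ + q₂.derivative) s :=
    mem_of_superset (Complex.isOpen_slitPlane.mem_nhds hs) fun z hz =>
      (hasDerivAt_logProfile q₁ q₂ hz).deriv
  have h2 := (hasDerivAt_inv hs0).mul (hasDerivAt_logProfile (m := n - 1) q₁.derivative
    ((n - 1 : ℕ) * q₂ + q₂.derivative) hs)
  have hn' : (n : ℂ) - 2 = ((n - 1 : ℕ) : ℂ) - 1 := by
    push_cast [hn]
    ring
  rw [radialOp, h1.deriv_eq, h1.self_of_nhds, hn',
    (show HasDerivAt (fun s => s⁻¹ * logProfile (n - 1) q₁.derivative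
      ((n - 1 : ℕ) * q₂ + q₂.derivative) s) _ s from h2).deriv]
  simp only [logProfile, polyOp, Polynomial.eval_add, Polynomial.eval_sub, Polynomial.eval_mul,
    Polynomial.eval_natCast, Polynomial.eval_C, map_add, Polynomial.derivative_mul,
    Polynomial.derivative_natCast, zero_mul, zero_add, map_neg, Polynomial.eval_neg]
  field_simp
  ring

theorem radialOp_eventuallyEq {n : ℕ} {P Q : ℂ → ℂ} {s : ℂ} (h : P =ᶠ[𝓝 s] Q) :
    radialOp n P =ᶠ[𝓝 s] radialOp n Q := by
  filter_upwards [h.deriv.deriv, h.deriv] with z h1 h2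
  rw [radialOp, radialOp, h1, h2]

theorem iterate_radialOp_eventuallyEq_logProfile {n : ℕ} (hn : 1 ≤ n) {P : ℂ → ℂ} {q₁ q₂ : ℂ[X]}
    {s : ℂ} (hs : s ∈ Complex.slitPlane) (h : P =ᶠ[𝓝 s] logProfile (n - 1) q₁ q₂) (k : ℕ) :
    (radialOp n)^[k] P =ᶠ[𝓝 s]
      logProfile (n - 1) ((polyOp (n - 1 : ℕ))^[k] q₁) ((polyOp (-(n - 1 : ℕ)))^[k] q₂) := by
  induction k with
  | zero => exact h
  | succ k ih =>
    simp only [Function.iterate_succ_apply']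
    refine (radialOp_eventuallyEq ih).trans ?_
    exact mem_of_superset (Complex.isOpen_slitPlane.mem_nhds hs) fun z hz =>
      radialOp_logProfile hn _ _ hz

/-- `polyOp c` is (c - D)D with commuting factors: D^k reduces the monomial to the constant z·k!, on
which c - D is multiplication by c. -/
theorem iterate_polyOp_C_mul_X_pow (c z : ℂ) (k : ℕ) :
    (polyOp c)^[k] (Polynomial.C z * Polynomial.X ^ k) =
      Polynomial.C (c ^ k * (z * k.factorial)) := by
  set A : ℂ[X] → ℂ[X] := fun q => Polynomial.C c * q - q.derivative with hA
  have h1 : polyOp c = A ∘ Polynomial.derivative := by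
    ext1 q
    simp [polyOp, hA]
  have h2 : Function.Commute A (Polynomial.derivative : ℂ[X] → ℂ[X]) := by
    intro q
    simp [hA]
  have h3 : ∀ (j : ℕ) (w : ℂ), A^[j] (Polynomial.C w) = Polynomial.C (c ^ j * w) := by
    intro j w
    induction j with
    | zero => simp
    | succ j ih =>
      rw [Function.iterate_succ_apply', ih]
      simp only [hA, Polynomial.derivative_C, sub_zero, ← Polynomial.C_mul]
      ring_nf
  rw [h1, h2.comp_iterate, Function.comp_apply, Polynomial.iterate_derivative_C_mul,
    Polynomial.iterate_derivative_X_pow_eq_natCast_mul, Nat.sub_self, pow_zero, mul_one,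
    Nat.descFactorial_self, ← Polynomial.C_eq_natCast, ← Polynomial.C_mul, h3]

theorem logProfile_eq_radial {n r : ℕ} (a b : ℂ) {t : ℝ} (ht : 0 < t) :
    logProfile (n - 1) (Polynomial.C a * Polynomial.X ^ (r - 1))
      (Polynomial.C b * Polynomial.X ^ (r - 1)) t = radial n r a b t := by
  simp only [logProfile, radial, Polynomial.eval_mul, Polynomial.eval_C, Polynomial.eval_pow,
    Polynomial.eval_X, Complex.ofReal_log ht.le]
  ring

theorem frequently_ofReal {t₀ : ℝ} {p : ℂ → Prop} (h : ∀ᶠ t : ℝ in 𝓝 t₀, p t) :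
    ∃ᶠ z in 𝓝[≠] (t₀ : ℂ), p z := by
  have h1 : Tendsto (fun t : ℝ => (t : ℂ)) (𝓝[≠] t₀) (𝓝[≠] (t₀ : ℂ)) :=
    tendsto_nhdsWithin_iff.2 ⟨Complex.continuous_ofReal.continuousAt.mono_left nhdsWithin_le_nhds,
      eventually_nhdsWithin_of_forall fun t ht => by simpa using ht⟩
  exact h1.frequently (h.filter_mono nhdsWithin_le_nhds).frequently

variable {n r : ℕ} {a b : ℂ} {V : Set ℂ} {P : ℂ → ℂ}

theorem IsExtensionPos.exists_eventuallyEq (hE : IsExtensionPos (radial n r a b) V P) :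
    ∃ t₀ ∈ V, t₀ ∈ Complex.slitPlane ∧
      P =ᶠ[𝓝 t₀] logProfile (n - 1) (Polynomial.C a * Polynomial.X ^ (r - 1))
        (Polynomial.C b * Polynomial.X ^ (r - 1)) := by
  obtain ⟨t₀, ht₀, hV, h⟩ := hE.agree
  have hs : (t₀ : ℂ) ∈ Complex.slitPlane := Complex.ofReal_mem_slitPlane.2 ht₀
  refine ⟨t₀, hV, hs, ?_⟩
  refine ((hE.analytic _ hV).frequently_eq_iff_eventually_eq
    (analyticOnNhd_logProfile _ _ _ _ hs)).1 (frequently_ofReal ?_)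
  filter_upwards [h, lt_mem_nhds ht₀] with t ht ht0
  rw [ht, logProfile_eq_radial a b ht0]

/-- `L^[r-1] p_r` is a solution of the homogeneous equation. -/
theorem IsExtensionPos.iterate_radialOp_pred (hE : IsExtensionPos (radial n r a b) V P)
    (hn : 1 ≤ n) : ∀ s ∈ V, (radialOp n)^[r - 1] P s =
      ((n - 1 : ℕ) : ℂ) ^ (r - 1) * (a * (r - 1).factorial) +
        s ^ (n - 1) * ((-((n - 1 : ℕ) : ℂ)) ^ (r - 1) * (b * (r - 1).factorial)) := by
  obtain ⟨t₀, hV, hs, h⟩ := hE.exists_eventuallyEq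
  have h1 := iterate_radialOp_eventuallyEq_logProfile hn hs h (r - 1)
  simp only [iterate_polyOp_C_mul_X_pow] at h1
  refine (analyticOnNhd_iterate_radialOp hE.analytic n (r - 1)).eqOn_of_preconnected_of_eventuallyEq
    ?_ hE.isPreconnected hV (h1.trans (Eventually.of_forall fun s => ?_))
  · exact analyticOnNhd_const.add ((analyticOnNhd_id.pow _).mul analyticOnNhd_const)
  · simp [logProfile]

theorem IsExtensionPos.iterate_radialOp (hE : IsExtensionPos (radial n r a b) V P)
    (hn : 1 ≤ n) (hr : 1 ≤ r) : ∀ s ∈ V, (radialOp n)^[r] P s = 0 := by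
  obtain ⟨t₀, hV, hs, h⟩ := hE.exists_eventuallyEq
  have h1 := iterate_radialOp_eventuallyEq_logProfile hn hs h r
  -- After r - 1 applications both polynomials are constants, so one more annihilates them.
  obtain ⟨k, rfl⟩ := Nat.exists_eq_add_of_le' hr
  simp only [Nat.add_sub_cancel, Function.iterate_succ_apply' (polyOp _),
    iterate_polyOp_C_mul_X_pow] at h1
  refine (analyticOnNhd_iterate_radialOp hE.analytic n _).eqOn_zero_of_preconnected_of_eventuallyEq_zero
    hE.isPreconnected hV (h1.trans (Eventually.of_forall fun s => ?_))
  simp only [logProfile, polyOp, Polynomial.derivative_C, map_zero, mul_zero, sub_zero,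
    Polynomial.eval_zero, add_zero, Pi.zero_apply]

end Radial

end

/-! ### Non-vanishing of the product, and existence of the extensions. -/

section

open Filter Topology Set
open scoped ContDiff Manifold

section Nonvanishing

variable {n : ℕ}

theorem continuousAt_argT {y : Sphere n} (hd : denom y.1 ≠ 0) :
    ContinuousAt (fun z : Sphere n => argT z.1) y :=
  ContinuousAt.comp (f := fun z : Sphere n => z.1) (g := argT)
    (contDiffAt_argT (k := 0) hd).continuousAt continuous_subtype_val.continuousAt

theorem continuousAt_argX {y : Sphere n} (hd : denom y.1 ≠ 0) :
    ContinuousAt (fun z : Sphere n => argX z.1) y :=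
  ContinuousAt.comp (f := fun z : Sphere n => z.1) (g := argX)
    (contDiffAt_argX (k := 0) hd).continuousAt continuous_subtype_val.continuousAt

theorem eventually_stereoCurve_mem {O : Set (Sphere n)} (hO : IsOpen O) {y : Sphere n}
    (hy : y ∈ O) {v : EuclideanSpace ℝ (Fin (n + 1))} (hv : ∀ t, ‖stereoCurve y.1 v t‖ = 1) :
    ∀ᶠ t in 𝓝 0, ∃ z ∈ O, z.1 = stereoCurve y.1 v t := by
  let γ : ℝ → Sphere n := fun t => ⟨stereoCurve y.1 v t, by simpa using hv t⟩
  have hγ : Continuous γ := (continuous_stereoCurve y.1 v).subtype_mk _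
  have hγ0 : γ 0 = y := Subtype.ext (stereoCurve_zero _ _)
  filter_upwards [hγ.continuousAt.preimage_mem_nhds (hO.mem_nhds (by rwa [hγ0]))] with t ht
  exact ⟨γ t, ht, rfl⟩

/-- The velocities of X along a tangent frame satisfy the tight-frame identity with c = (2/d)² ≠ 0.
-/
theorem span_velocities_argX (hn : 2 ≤ n) {O : Set (Sphere n)} (hO : IsOpen O)
    (hd : ∀ y ∈ O, denom y.1 ≠ 0) : ∀ x ∈ (fun z : Sphere n => argX z.1) '' O,
      Submodule.span ℂ (velocities ((fun z : Sphere n => argX z.1) '' O) x) = ⊤ := by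
  rintro _ ⟨y, hy, rfl⟩
  obtain ⟨v, hv, hv1, -⟩ := exists_tension_eq_sum y
  have h1 := span_range_eq_top_of_sum_mul (pow_ne_zero 2 (div_ne_zero two_ne_zero (hd y hy)))
    (sum_velX_mul_velX hn (hd y hy) hv)
  rw [eq_top_iff, ← h1]
  refine Submodule.span_mono ?_
  rintro _ ⟨i, rfl⟩
  obtain ⟨X₁, hX, hX0, -⟩ := exists_hasDerivAt_argX (hd y hy) (v i)
  refine ⟨fun t => argX (stereoCurve y.1 (v i) t), by simp [stereoCurve_zero],
    hX.self_of_nhds.congr_deriv hX0, ?_⟩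
  filter_upwards [eventually_stereoCurve_mem hO hy (hv1 i)] with t ht
  obtain ⟨z, hz, hzt⟩ := ht
  exact ⟨z, hz, by simp only [hzt]⟩

theorem span_velocities_argT (hn : 2 ≤ n) {O : Set (Sphere n)} (hO : IsOpen O)
    (hd : ∀ y ∈ O, denom y.1 ≠ 0) : ∀ x ∈ (fun z : Sphere n => argT z.1) '' O,
      Submodule.span ℂ (velocities ((fun z : Sphere n => argT z.1) '' O) x) = ⊤ := by
  rintro _ ⟨y, hy, rfl⟩
  obtain ⟨v, hv, hv1, -⟩ := exists_tension_eq_sum y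
  -- The squares sum to -d² ≠ 0, so some frame vector moves T. A single nonzero velocity spans ℂ.
  have h1 : ∃ i, denom (v i) ≠ 0 := by
    by_contra! h
    have h2 := sum_denom_mul_denom hn hv
    simp only [h] at h2
    simp [hd y hy] at h2
  obtain ⟨i, hi⟩ := h1
  have h3 : velT y.1 (v i) ≠ 0 :=
    div_ne_zero (mul_ne_zero (by norm_num) hi) (pow_ne_zero 2 (hd y hy))
  obtain ⟨s₁, hs, hs0, -⟩ := exists_hasDerivAt_argT (hd y hy) (hv1 i)
  have h4 : velT y.1 (v i) ∈ velocities ((fun z : Sphere n => argT z.1) '' O) (argT y.1) := by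
    refine ⟨fun t => argT (stereoCurve y.1 (v i) t), by simp [stereoCurve_zero],
      hs.self_of_nhds.congr_deriv hs0, ?_⟩
    filter_upwards [eventually_stereoCurve_mem hO hy (hv1 i)] with t ht
    obtain ⟨z, hz, hzt⟩ := ht
    exact ⟨z, hz, by simp only [hzt]⟩
  rw [eq_top_iff]
  intro c _
  have h5 : c = (c / velT y.1 (v i)) • velT y.1 (v i) := by
    rw [smul_eq_mul, div_mul_cancel₀ _ h3]
  rw [h5]
  exact Submodule.smul_mem _ _ (Submodule.subset_span h4)

variable {h : EuclideanSpace ℝ (Fin (n - 1)) → ℂ} {V : Set ℂ} {U : Set (Fin (n - 1) → ℂ)}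
  {W : Set (Sphere n)} {Q : ℂ → ℂ} {H : (Fin (n - 1) → ℂ) → ℂ}

/-- If `Q(s) H(X)` vanishes on an open subset of the sphere, then one of the factors vanishes
identically. -/
theorem eq_zero_or_eventuallyEq_zero_of_sphereFun_eq_zero (hn : 2 ≤ n)
    (hE : IsExtensionReal h U H) (hh : InnerProductSpace.HarmonicOnNhd h univ)
    (hQ : AnalyticOnNhd ℂ Q V) (hW : IsOpen W) (hm : MapsInto W V U)
    (h0 : ∀ y ∈ W, sphereFun Q H y = 0) {y : Sphere n} (hy : y ∈ W) :
    h = 0 ∨ Q =ᶠ[𝓝 (argT y.1)] 0 := by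
  by_cases hQ0 : ∀ y ∈ W, Q (argT y.1) = 0
  · right
    refine eventuallyEq_zero_of_span_velocities
      (span_velocities_argT hn hW fun z hz => (hm z hz).1) (hQ.mono ?_) ?_ ⟨y, hy, rfl⟩
    · rintro _ ⟨z, hz, rfl⟩
      exact (hm z hz).2.1
    · rintro _ ⟨z, hz, rfl⟩
      exact hQ0 z hz
  · left
    push Not at hQ0
    obtain ⟨y₁, hy₁, hne⟩ := hQ0
    -- Where Q(T) is nonzero, an open condition, the product forces H(X) = 0, and the identity
    -- theorem applies to H on that smaller open set.
    have hev : ∀ᶠ z in 𝓝 y₁, Q (argT z.1) ≠ 0 ∧ z ∈ W := by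
      have hc : ContinuousAt (fun z : Sphere n => Q (argT z.1)) y₁ :=
        ContinuousAt.comp (f := fun z : Sphere n => argT z.1)
          (hQ _ (hm y₁ hy₁).2.1).continuousAt (continuousAt_argT (hm y₁ hy₁).1)
      exact (hc.eventually_ne hne).and (hW.mem_nhds hy₁)
    obtain ⟨O, hO, hOo, hyO⟩ := eventually_nhds_iff.1 hev
    refine hE.eq_zero_of_eventuallyEq_zero hh (hm y₁ hy₁).2.2
      (eventuallyEq_zero_of_span_velocities
        (span_velocities_argX hn hOo fun z hz => (hm z (hO z hz).2).1) (hE.analytic.mono ?_) ?_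
        ⟨y₁, hyO, rfl⟩)
    · rintro _ ⟨z, hz, rfl⟩
      exact (hm z (hO z hz).2).2.2
    · rintro _ ⟨z, hz, rfl⟩
      exact (mul_eq_zero.1 (h0 z (hO z hz).2)).resolve_left (hO z hz).1

/-- Differentiating leaves m s₀^{m-1} B = 0, hence B = 0 and then A = 0. -/
theorem eq_zero_of_eventually_add_pow_mul_eq_zero {m : ℕ} (hm : m ≠ 0) {A B s₀ : ℂ}
    (hs₀ : s₀ ≠ 0) (h0 : ∀ᶠ s in 𝓝 s₀, A + s ^ m * B = 0) : A = 0 ∧ B = 0 := by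
  have h1 : HasDerivAt (fun s : ℂ => A + s ^ m * B) (m * s₀ ^ (m - 1) * B) s₀ :=
    ((hasDerivAt_pow m s₀).mul_const B).const_add A
  have h2 : (fun s : ℂ => A + s ^ m * B) =ᶠ[𝓝 s₀] fun _ => 0 := h0
  have h3 := (h1.congr_of_eventuallyEq h2.symm).unique (hasDerivAt_const s₀ (0 : ℂ))
  have hB : B = 0 := by
    simpa [hm, hs₀] using h3
  have h4 := h0.self_of_nhds
  rw [hB] at h4
  exact ⟨by simpa using h4, hB⟩

end Nonvanishing

section Existence

variable {n : ℕ}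

theorem isPreconnected_slitPlane : IsPreconnected Complex.slitPlane :=
  (Complex.starConvex_one_slitPlane.isPathConnected
    Complex.one_mem_slitPlane).isConnected.isPreconnected

theorem isExtensionPos_logProfile (n r : ℕ) (a b : ℂ) :
    IsExtensionPos (radial n r a b) Complex.slitPlane
      (logProfile (n - 1) (Polynomial.C a * Polynomial.X ^ (r - 1))
        (Polynomial.C b * Polynomial.X ^ (r - 1))) where
  isOpen := Complex.isOpen_slitPlane
  isPreconnected := isPreconnected_slitPlane
  analytic := analyticOnNhd_logProfile _ _ _
  agree := ⟨1, one_pos, by simp [Complex.one_mem_slitPlane], by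
    filter_upwards [lt_mem_nhds one_pos] with t ht
    exact logProfile_eq_radial a b ht⟩

/-- The real point `(2y_3/y_2, …)`, the value of `argX` where `y_1 = 0`. -/
def realArgX (y : Sphere n) : EuclideanSpace ℝ (Fin (n - 1)) :=
  WithLp.toLp 2 fun k => 2 * y.1 ⟨k.1 + 2, by have := k.2; omega⟩ / y.1 1

theorem argX_eq_realInclusion {y : Sphere n} (hy : y.1 0 = 0) :
    argX y.1 = realInclusion (n - 1) (realArgX y) := by
  ext k
  simp [argX, realInclusion_apply, realArgX, denom, hy]

end Existence

end

end PolyharmonicSphere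

end

theorem theorem5p3 (n r : ℕ) (hn : 2 ≤ n) (hr : 1 ≤ r)
    (h : EuclideanSpace ℝ (Fin (n - 1)) → ℂ)
    (hharm : InnerProductSpace.HarmonicOnNhd h Set.univ)
    (hconst : ¬ ∃ c : ℂ, ∀ x, h x = c)
    (a b : ℂ) (hab : (a, b) ≠ (0, 0)) :
    -- local extensions exist around every point at which both arguments are real, the first positive
    (∀ q : PolyharmonicSphere.Sphere n, q.1 0 = 0 → 0 < q.1 1 →
      ∃ (V : Set ℂ) (P : ℂ → ℂ) (U : Set (Fin (n - 1) → ℂ)) (H : (Fin (n - 1) → ℂ) → ℂ)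
        (W : Set (PolyharmonicSphere.Sphere n)),
        PolyharmonicSphere.IsExtensionPos (PolyharmonicSphere.radial n r a b) V P ∧
        (∀ t : ℝ, 0 < t → (t : ℂ) ∈ V → P (t : ℂ) = PolyharmonicSphere.radial n r a b t) ∧
        PolyharmonicSphere.IsExtensionReal h U H ∧
        (∀ x : EuclideanSpace ℝ (Fin (n - 1)), (fun k => (x k : ℂ)) ∈ U →
          H (fun k => (x k : ℂ)) = h x) ∧
        IsOpen W ∧ q ∈ W ∧ PolyharmonicSphere.MapsInto W V U) ∧
    -- whatever local extensions are used, the resulting function is proper r-harmonic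
    (∀ (V : Set ℂ) (P : ℂ → ℂ) (U : Set (Fin (n - 1) → ℂ)) (H : (Fin (n - 1) → ℂ) → ℂ)
        (W : Set (PolyharmonicSphere.Sphere n)),
        PolyharmonicSphere.IsExtensionPos (PolyharmonicSphere.radial n r a b) V P →
        PolyharmonicSphere.IsExtensionReal h U H →
        IsOpen W → W.Nonempty → PolyharmonicSphere.MapsInto W V U →
        PolyharmonicSphere.IsProperHarmonicOn r (PolyharmonicSphere.sphereFun P H) W) := by
  open PolyharmonicSphere in
  refine ⟨fun q hq0 hq1 => ?_, fun V P U H W hP hH hW hWne hm => ?_⟩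
  · obtain ⟨R, hR, H, hH, hHh⟩ := exists_holomorphic_extension_of_harmonic hharm (realArgX q)
    have hd : denom q.1 ≠ 0 := by
      simp [denom, hq0, hq1.ne']
    -- At q the argument T is the positive real 2/q_2, so the principal logarithm on the slit plane
    -- provides P.
    have hT : argT q.1 ∈ Complex.slitPlane := by
      have h1 : argT q.1 = ((2 / q.1 1 : ℝ) : ℂ) := by
        rw [argT_sphere, denom, hq0]
        simp
      rw [h1, Complex.ofReal_mem_slitPlane]
      positivity
    have hball := Metric.ball_mem_nhds (realInclusion (n - 1) (realArgX q)) hR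
    have hev : ∀ᶠ z : Sphere n in 𝓝 q, denom z.1 ≠ 0 ∧ argT z.1 ∈ Complex.slitPlane ∧
        argX z.1 ∈ Metric.ball (realInclusion (n - 1) (realArgX q)) R := by
      refine Filter.Eventually.and ?_ (Filter.Eventually.and ?_ ?_)
      · exact ((contDiff_denom (k := 0)).continuous.comp
          continuous_subtype_val).continuousAt.eventually_ne hd
      · exact (continuousAt_argT hd).preimage_mem_nhds (Complex.isOpen_slitPlane.mem_nhds hT)
      · exact (continuousAt_argX hd).preimage_mem_nhds (by rwa [argX_eq_realInclusion hq0])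
    obtain ⟨W, hW, hWo, hqW⟩ := eventually_nhds_iff.1 hev
    refine ⟨Complex.slitPlane, _, _, H, W, isExtensionPos_logProfile n r a b,
      fun t ht _ => logProfile_eq_radial a b ht, ⟨Metric.isOpen_ball,
      (convex_ball _ _).isPreconnected, hH, realArgX q, Metric.mem_ball_self hR, ?_⟩,
      fun x hx => hHh x hx, hWo, hqW, hW⟩
    filter_upwards [(realInclusion (n - 1)).continuous.continuousAt.preimage_mem_nhds hball]
      with x hx
    exact hHh x hx
  · have hiter := iterate_tension_eq hn hW hm hP.analytic hH.analytic
      (hH.complexLaplacian_eq_zero hharm)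
    refine ⟨contMDiffOn_sphereFun hP.analytic hH.analytic hm, fun y hy => ?_, ?_⟩
    · rw [hiter r y hy, sphereFun, hP.iterate_radialOp (by omega) hr _ (hm y hy).2.1, zero_mul]
    -- If τ^{r-1}f_r vanishes on W, then h = 0, which is constant, or L^{r-1}P vanishes near a
    -- point. Its explicit form A + s^{n-1}B then forces a = b = 0, because n - 1 and (r-1)! are
    -- nonzero.
    · by_contra! h0
      obtain ⟨y, hy⟩ := hWne
      obtain ⟨hd, hV, hU⟩ := hm y hy
      rcases eq_zero_or_eventuallyEq_zero_of_sphereFun_eq_zero hn hH hharm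
        (analyticOnNhd_iterate_radialOp hP.analytic n (r - 1)) hW hm
        (fun z hz => by rw [← hiter (r - 1) z hz]; exact h0 z hz) hy with h1 | h1
      · exact hconst ⟨0, fun x => by rw [h1]; rfl⟩
      · have h2 : ∀ᶠ s in 𝓝 (argT y.1), ((n - 1 : ℕ) : ℂ) ^ (r - 1) * (a * (r - 1).factorial) +
            s ^ (n - 1) * ((-((n - 1 : ℕ) : ℂ)) ^ (r - 1) * (b * (r - 1).factorial)) = 0 := by
          filter_upwards [h1, hP.isOpen.mem_nhds hV] with s hs hsV
          rw [← hP.iterate_radialOp_pred (by omega) s hsV, hs]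
          rfl
        have h3 := eq_zero_of_eventually_add_pow_mul_eq_zero (by omega)
          (by rw [argT_sphere]; exact div_ne_zero two_ne_zero hd) h2
        have hn1 : ((n - 1 : ℕ) : ℂ) ≠ 0 := by
          exact_mod_cast (by omega : n - 1 ≠ 0)
        have hf : (((r - 1).factorial : ℕ) : ℂ) ≠ 0 := by
          exact_mod_cast (Nat.factorial_pos _).ne'
        refine hab (Prod.ext ?_ ?_)
        · exact (mul_eq_zero.1 ((mul_eq_zero.1 h3.1).resolve_left
            (pow_ne_zero _ hn1))).resolve_right hf
        · exact (mul_eq_zero.1 ((mul_eq_zero.1 h3.2).resolve_left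
            (pow_ne_zero _ (neg_ne_zero.2 hn1)))).resolve_right hf
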